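/- **Setting.** $\mathbb R^4_2$ is $\mathbb R^4$ with the scalar product $a\cdot b=-a_1b_1+a_2b_2-a_3b_3+a_4b_4$, and $\mathbb D=\{u+\mathrm jv:\ u,v\in\mathbb R,\ \mathrm j^2=1\}$ are the double numbers, identified with the $(u,v)$-plane; scalar products are extended bilinearly to $\mathbb D^4$. A *time-like surface* $M=(D,x)$ is a $C^\infty$ map $x:D\to\mathbb R^4_2$ on an open set $D$ of the $(u,v)$-plane in isothermal coordinates: $E=x_u^2=-x_v^2<0$ and $x_u\cdot x_v=0$. It is *minimal* if its mean curvature vector vanishes. The curvature of the normal connection is $\varkappa=R^N(X_1,X_2)n_2\cdot n_1$, where $R^N$ is the curvature tensor of the normal connection and $(X_1,X_2,n_1,n_2)$ is a right oriented orthonormal frame with $X_1,X_2$ tangent, $n_1,n_2$ normal and $X_1^2=n_1^2=-1$. Put $\Phi=x_u+\mathrm jx_v$ and, for minimal $M$, $\Phi'=\partial\Phi/\partial t=\frac12(\Phi_u+\mathrm j\Phi_v)$, and let $\Phi'^{\perp}$ be the projection of $\Phi'$ to the complexified normal plane; $M$ is *of general type* if $\Phi'^{\perp}\cdot\Phi'^{\perp}$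 is an invertible double number at every point of $D$. A *strong isometry* is an isometry (a smooth diffeomorphism which preserves the first fundamental form) which preserves $\varkappa$. **Associated families.** Let $M=(D,x)$ be minimal time-like. A harmonic conjugate of $x$ is a smooth $y:D\to\mathbb R^4_2$ with $y_u=x_v$, $y_v=x_u$; it gives the surfaces $M_\theta=(D,\ x\cosh\theta+y\sinh\theta)$, $\theta\in\mathbb R$, and the conjugate surface $\bar M=(\mathrm jD,\ s\mapsto y(\mathrm js))$. For a linear map $A$ with $Aa\cdot Ab=-a\cdot b$ and $\det A=1$ and a vector $b_0\in\mathbb R^4_2$ one puts $M^a=(\mathrm jD,\ s\mapsto Ax(\mathrm js)+b_0)$. Applying these constructions in succession gives $\bar M^a=(D,\ Ay+b_0)$ and, with a harmonic conjugate $z$ of $Ay+b_0$, the family $\bar M^a_\theta=(D,\ (Ay+b_0)\cosh\theta+z\sinh\theta)$. The natural maps $M\to M_\theta$ and $M\to\bar M^a_\theta$ are the identity in the coordinates $(u,v)\in D$. **Theorem.** Let $M=(D,x)$ be a minimal time-like surface of general type in $\mathbb R^4_2$. (0) Every point of $D$ has an open neighborhood over which the harmonic conjugates above, hence the families $M_\theta$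 and $\bar M^a_\theta$, exist. (1) Whenever they are defined on $D$ (for any choice of $y$, respectively of $y,A,b_0,z$), all surfaces $M_\theta$ and $\bar M^a_\theta$, $\theta\in\mathbb R$, are minimal time-like surfaces, and the natural maps $M\to M_\theta$ and $M\to\bar M^a_\theta$ are strong isometries. (2) Conversely, let $\hat M=(\hat D,\hat x)$ be a minimal time-like surface of general type, let $p_0\in D$, $\hat p_0\in\hat D$, and suppose that a strong isometry from a neighborhood of $p_0$ in $M$ onto a neighborhood of $\hat p_0$ in $\hat M$ sends $p_0$ to $\hat p_0$. Then there is $\theta\in\mathbb R$ such that a neighborhood of $\hat p_0$ in $\hat M$ is obtained through a proper motion $w\mapsto Bw+d$ ($B$ preserves the scalar product, $\det B=1$) from a neighborhood, in $M_\theta$ or in $\bar M^a_\theta$, of the point that corresponds to $p_0$ under the natural map, this point being sent to $\hat p_0$. Here it does not matter on which neighborhood of $p_0$ and with which choice of $y$, respectively of $y,A,b_0,z$, the family is formed. -/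

import Mathlib

open scoped ContDiff

noncomputable section

namespace TimelikeSurface

/-- The scalar product `-a₁b₁ + a₂b₂ - a₃b₃ + a₄b₄`. Over `ℝ` it is the neutral scalar product
of `ℝ⁴₂`; over the double numbers it is its bilinear extension. -/
def dot {R : Type*} [CommRing R] (a b : Fin 4 → R) : R :=
  -(a 0 * b 0) + a 1 * b 1 - a 2 * b 2 + a 3 * b 3

/-- The pseudo-Euclidean space `ℝ⁴₂`, with the scalar product `dot`. -/
abbrev R42 : Type := Fin 4 → ℝ

/-- The plane of the coordinates `(u, v)`, i.e. of `t = u + j v`. -/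
abbrev Plane : Type := ℝ × ℝ

/-- Double numbers `u + j v`, `j² = 1`. -/
abbrev DoubleNumber : Type := QuadraticAlgebra ℝ 1 0

/-- The set of non-invertible double numbers: `|t|² = t * conj t = u² - v² = 0`. -/
def nonInvertibles : Set DoubleNumber := {t | QuadraticAlgebra.norm t = 0}

/-- Multiplication by `j` on the coordinate plane: `j (u + j v) = v + j u`. -/
def mulJ (t : Plane) : Plane := (t.2, t.1)

/-- A map `x : D → ℝ⁴₂` on a subset `D` of the coordinate plane. Only the values of `map` on
`domain` matter. -/
structure Patch where
  domain : Set Plane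
  map : Plane → R42

/-- The piece of `M` over `U`. -/
def Patch.restrict (M : Patch) (U : Set Plane) : Patch := ⟨U, M.map⟩

/-- Partial derivative in `u`. -/
def du (x : Plane → R42) (p : Plane) : R42 := fderiv ℝ x p (1, 0)

/-- Partial derivative in `v`. -/
def dv (x : Plane → R42) (p : Plane) : R42 := fderiv ℝ x p (0, 1)

/-- The coefficient `E` of the first fundamental form `E du² + 2 F du dv + G dv²`. -/
def coeffE (x : Plane → R42) (p : Plane) : ℝ := dot (du x p) (du x p)

/-- The coefficient `F` of the first fundamental form. -/
def coeffF (x : Plane → R42) (p : Plane) : ℝ := dot (du x p) (dv x p)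

/-- The coefficient `G` of the first fundamental form. -/
def coeffG (x : Plane → R42) (p : Plane) : ℝ := dot (dv x p) (dv x p)

/-- A smooth time-like surface in `ℝ⁴₂`, parametrized by isothermal coordinates `(u, v)` in an
open set, with `E < 0`. (The conditions on `E, F, G` force `x` to be an immersion whose induced
metric is indefinite.) -/
structure IsTimelike (M : Patch) : Prop where
  isOpen : IsOpen M.domain
  contDiffOn : ContDiffOn ℝ ∞ M.map M.domain
  E_eq_neg_G : ∀ p ∈ M.domain, coeffE M.map p = -coeffG M.map p
  F_eq_zero : ∀ p ∈ M.domain, coeffF M.map p = 0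
  E_neg : ∀ p ∈ M.domain, coeffE M.map p < 0

/-- The orthogonal projection of `w` to the tangent plane, spanned by `x_u, x_v`, for the
non-degenerate first fundamental form. -/
def tangentProj (x : Plane → R42) (p : Plane) (w : R42) : R42 :=
  (coeffE x p * coeffG x p - coeffF x p ^ 2)⁻¹ •
    ((coeffG x p * dot w (du x p) - coeffF x p * dot w (dv x p)) • du x p +
      (coeffE x p * dot w (dv x p) - coeffF x p * dot w (du x p)) • dv x p)

/-- The orthogonal projection to the normal plane. -/
def normalProj (x : Plane → R42) (p : Plane) (w : R42) : R42 := w - tangentProj x p w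

/-- The second fundamental form `σ(dx a, dx b)`, i.e. the normal part of the second derivative. -/
def secondForm (x : Plane → R42) (p a b : Plane) : R42 :=
  normalProj x p (fderiv ℝ (fun q => fderiv ℝ x q b) p a)

/-- The mean curvature vector: half the trace of the second fundamental form with respect to the
first. -/
def meanCurvature (x : Plane → R42) (p : Plane) : R42 :=
  (1 / 2 : ℝ) • (coeffE x p * coeffG x p - coeffF x p ^ 2)⁻¹ •
    (coeffG x p • secondForm x p (1, 0) (1, 0) - (2 * coeffF x p) • secondForm x p (1, 0) (0, 1) +
      coeffE x p • secondForm x p (0, 1) (0, 1))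

/-- A minimal time-like surface, in isothermal coordinates with `E < 0`. -/
structure IsMinimal (M : Patch) : Prop extends IsTimelike M where
  meanCurvature_eq_zero : ∀ p ∈ M.domain, meanCurvature M.map p = 0

/-- The covariant derivative in the normal bundle `∇^N_{dx a} ν = (∂_a ν)^⊥` of a normal vector
field `ν`. -/
def normalDeriv (x : Plane → R42) (a : Plane) (ν : Plane → R42) (p : Plane) : R42 :=
  normalProj x p (fderiv ℝ ν p a)

/-- The curvature tensor `R^N(dx a, dx b) n` of the normal connection at `p`. The directions `a, b`
are extended to constant (hence commuting) coordinate fields, and the normal vector `n` at `p` is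
extended to the normal field `q ↦ n^⊥`. -/
def normalCurvatureTensor (x : Plane → R42) (p a b : Plane) (n : R42) : R42 :=
  normalDeriv x a (normalDeriv x b fun q => normalProj x q n) p -
    normalDeriv x b (normalDeriv x a fun q => normalProj x q n) p

/-- `(X₁, X₂, n₁, n₂)`, with `X₁ = dx a` and `X₂ = dx b`, is a right oriented orthonormal basis of
`ℝ⁴₂` at `p`, where `X₁, X₂` are tangent, `n₁, n₂` are normal, and `X₁² = n₁² = -1`,
`X₂² = n₂² = 1`. -/
structure IsAdaptedFrame (x : Plane → R42) (p a b : Plane) (n₁ n₂ : R42) : Prop where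
  tangent₁₁ : dot (fderiv ℝ x p a) (fderiv ℝ x p a) = -1
  tangent₂₂ : dot (fderiv ℝ x p b) (fderiv ℝ x p b) = 1
  tangent₁₂ : dot (fderiv ℝ x p a) (fderiv ℝ x p b) = 0
  normal₁₁ : dot n₁ n₁ = -1
  normal₂₂ : dot n₂ n₂ = 1
  normal₁₂ : dot n₁ n₂ = 0
  normal₁ : ∀ c : Plane, dot (fderiv ℝ x p c) n₁ = 0
  normal₂ : ∀ c : Plane, dot (fderiv ℝ x p c) n₂ = 0
  rightOriented : 0 < (Matrix.of ![fderiv ℝ x p a, fderiv ℝ x p b, n₁, n₂]).det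

/-- `k` is the curvature of the normal connection `ϰ = R^N(X₁, X₂) n₂ · n₁` of `x` at `p`. On a
time-like surface adapted frames exist and this value does not depend on the frame. -/
def HasNormalCurvature (x : Plane → R42) (p : Plane) (k : ℝ) : Prop :=
  ∃ (a b : Plane) (n₁ n₂ : R42), IsAdaptedFrame x p a b n₁ n₂ ∧
    k = dot (normalCurvatureTensor x p a b n₂) n₁

/-- The vector of `𝔻⁴` with real part `a` and imaginary part `b`. -/
def toDouble (a b : R42) : Fin 4 → DoubleNumber := fun i => ⟨a i, b i⟩

/-- The real part of a vector of `𝔻⁴`. -/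
def rePart (w : Fin 4 → DoubleNumber) : R42 := fun i => (w i).re

/-- The imaginary part of a vector of `𝔻⁴`. -/
def imPart (w : Fin 4 → DoubleNumber) : R42 := fun i => (w i).im

/-- `∂Φ/∂t = (1/2) (∂Φ/∂u + j ∂Φ/∂v)` for a function `Φ` with values in `𝔻⁴`. -/
def derivT (Φ : Plane → Fin 4 → DoubleNumber) (p : Plane) : Fin 4 → DoubleNumber :=
  toDouble
    ((1 / 2 : ℝ) • (du (fun q => rePart (Φ q)) p + dv (fun q => imPart (Φ q)) p))
    ((1 / 2 : ℝ) • (du (fun q => imPart (Φ q)) p + dv (fun q => rePart (Φ q)) p))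

/-- The function `Φ = x_u + j x_v`. -/
def Phi (x : Plane → R42) (p : Plane) : Fin 4 → DoubleNumber := toDouble (du x p) (dv x p)

/-- The projection of `Φ' = ∂Φ/∂t` to the complexified normal plane. -/
def PhiPrimePerp (x : Plane → R42) (p : Plane) : Fin 4 → DoubleNumber :=
  toDouble (normalProj x p (rePart (derivT (Phi x) p))) (normalProj x p (imPart (derivT (Phi x) p)))

/-- A point is degenerate if the scalar square of `Φ'^⊥` is a non-invertible double number. -/
def IsDegenerate (x : Plane → R42) (p : Plane) : Prop :=
  dot (PhiPrimePerp x p) (PhiPrimePerp x p) ∈ nonInvertibles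

/-- A minimal time-like surface of general type: one without degenerate points. -/
structure IsGeneralType (M : Patch) : Prop extends IsMinimal M where
  nondegenerate : ∀ p ∈ M.domain, ¬ IsDegenerate M.map p

/-- `f` restricts to a smooth diffeomorphism of `D` onto `D'`. -/
def IsDiffeoOn (f : Plane → Plane) (D D' : Set Plane) : Prop :=
  ContDiffOn ℝ ∞ f D ∧ Set.MapsTo f D D' ∧
    ∃ g : Plane → Plane, ContDiffOn ℝ ∞ g D' ∧ Set.MapsTo g D' D ∧ Set.InvOn g f D D'

/-- `f`, written in coordinates, is an isometry of `M` onto `N`. -/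
def IsIsometry (M N : Patch) (f : Plane → Plane) : Prop :=
  IsDiffeoOn f M.domain N.domain ∧ ∀ p ∈ M.domain, ∀ a b : Plane,
    dot (fderiv ℝ N.map (f p) (fderiv ℝ f p a)) (fderiv ℝ N.map (f p) (fderiv ℝ f p b)) =
      dot (fderiv ℝ M.map p a) (fderiv ℝ M.map p b)

/-- A strong isometry: an isometry which preserves the curvature of the normal connection. -/
def IsStrongIsometry (M N : Patch) (f : Plane → Plane) : Prop :=
  IsIsometry M N f ∧ ∀ p ∈ M.domain, ∃ k : ℝ,
    HasNormalCurvature M.map p k ∧ HasNormalCurvature N.map (f p) k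

/-- `y` is (hyperbolically) harmonically conjugate to the position vector of `M` on the domain of
`M`: `y_u = x_v` and `y_v = x_u`. -/
def IsHarmonicConjugate (M : Patch) (y : Plane → R42) : Prop :=
  ContDiffOn ℝ ∞ y M.domain ∧ ∀ p ∈ M.domain, du y p = dv M.map p ∧ dv y p = du M.map p

/-- The member `M_θ = (D, x cosh θ + y sinh θ)` of the one-parameter family associated to
`M = (D, x)`, where `y` is harmonically conjugate to `x`. -/
def Patch.associated (M : Patch) (y : Plane → R42) (θ : ℝ) : Patch :=
  ⟨M.domain, fun t => Real.cosh θ • M.map t + Real.sinh θ • y t⟩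

/-- The conjugate minimal surface `(jD, s ↦ y(js))` of `M = (D, x)`, where `y` is harmonically
conjugate to `x`. -/
def Patch.conj (M : Patch) (y : Plane → R42) : Patch :=
  ⟨{s | mulJ s ∈ M.domain}, fun s => y (mulJ s)⟩

/-- A proper linear motion: an element of `SO(2,2)`. -/
def IsProperMotion (A : Matrix (Fin 4) (Fin 4) ℝ) : Prop :=
  (∀ a b : R42, dot (A.mulVec a) (A.mulVec b) = dot a b) ∧ A.det = 1

/-- A linear anti-isometry of `ℝ⁴₂` with determinant `1`. -/
def IsProperAntiIsometry (A : Matrix (Fin 4) (Fin 4) ℝ) : Prop :=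
  (∀ a b : R42, dot (A.mulVec a) (A.mulVec b) = -dot a b) ∧ A.det = 1

/-- The surface `M^a = (jD, s ↦ A x(js) + c)`, where `A` is an anti-isometry with
determinant `1`. -/
def Patch.anti (M : Patch) (A : Matrix (Fin 4) (Fin 4) ℝ) (c : R42) : Patch :=
  ⟨{s | mulJ s ∈ M.domain}, fun s => A.mulVec (M.map (mulJ s)) + c⟩

/-- The data which determine the surfaces `M̄^a_θ`, `θ ∈ ℝ`: a harmonic conjugate `y` for `M`,
which gives the conjugate surface `M̄`, an anti-isometry `A` with determinant `1` and a translation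
vector `c`, which give `M̄^a`, and a harmonic conjugate `z` for `M̄^a`. -/
structure IsConjAntiData (M : Patch) (y : Plane → R42) (A : Matrix (Fin 4) (Fin 4) ℝ) (c : R42)
    (z : Plane → R42) : Prop where
  conj_y : IsHarmonicConjugate M y
  anti_A : IsProperAntiIsometry A
  conj_z : IsHarmonicConjugate ((M.conj y).anti A c) z

/-- The surface `M̄^a_θ`. -/
def Patch.conjAntiAssociated (M : Patch) (y : Plane → R42) (A : Matrix (Fin 4) (Fin 4) ℝ) (c : R42)
    (z : Plane → R42) (θ : ℝ) : Patch :=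
  ((M.conj y).anti A c).associated z θ

/-- A neighborhood of the point `q` on `N` is obtained through a proper motion from a neighborhood
of the point `p` on `M`, with `p` going to `q`; `g` is the motion written in coordinates. -/
def IsLocalProperMotion (M : Patch) (p : Plane) (N : Patch) (q : Plane) : Prop :=
  ∃ (W W' : Set Plane) (g : Plane → Plane) (B : Matrix (Fin 4) (Fin 4) ℝ) (d : R42),
    IsOpen W ∧ p ∈ W ∧ W ⊆ M.domain ∧ IsOpen W' ∧ q ∈ W' ∧ W' ⊆ N.domain ∧
    IsDiffeoOn g W W' ∧ g p = q ∧ IsProperMotion B ∧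
    ∀ t ∈ W, N.map (g t) = B.mulVec (M.map t) + d

end TimelikeSurface

end

namespace TimelikeSurface

/-! ### The scalar product and determinants -/

section Algebra

/-! In the null coordinates σ = u + v, τ = u - v write dx = a dσ + b dτ. The isothermal conditions
say that a and b are null with a · b = E/2 < 0, and minimality becomes the wave equation x_uu =
x_vv, so that a depends only on σ and b only on τ (`IsMinimal.exists_isNullFrame`). With a₁, b₁ the
derivatives of a, b, the invariants are explicit: ϰ = -det(a, b, a₁, b₁) / (a · b)³
(`normalCurvature_eq`), and M is of general type exactly when a₁ · a₁ and b₁ · b₁ never vanish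
(`norm_dot_PhiPrimePerp`).

Passing to M_θ replaces (a, b) by (e^θ a, e^{-θ} b), and passing to M̄^a by (Aa, -Ab). Both keep a ·
b and the determinant, hence the metric and ϰ; they multiply a₁ · a₁ by e^{2θ} and by -1
respectively.

Conversely, an isometry preserves or exchanges the two null directions, so the second surface can be
pulled back to a null frame in the coordinates of M with the same a · b and the same determinant
(`exists_pullback`). By the Gram determinant (`det4_sq`) the product (a₁ · a₁)(b₁ · b₁) is also the
same. Its factors depend on σ alone and on τ alone, so the two functions a₁ · a₁ differ by a
constant factor k ≠ 0 (`exists_dot_a₁_eq_mul`). The member of a family with e^{2θ} = |k|, taken from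
M_θ if k > 0 and from M̄^a_θ if k < 0, then has all the invariants of the pulled back map. Rigidity
(`exists_motion`) finishes: equal invariants give at each point a proper motion between the frames,
and differentiating the frame relations shows that it is constant. -/

lemma dot_comm (a b : R42) : dot a b = dot b a := by simp only [dot]; ring

lemma dot_add_left (a b c : R42) : dot (a + b) c = dot a c + dot b c := by
  simp only [dot, Pi.add_apply]; ring

lemma dot_add_right (a b c : R42) : dot a (b + c) = dot a b + dot a c := by
  simp only [dot, Pi.add_apply]; ring

lemma dot_sub_left (a b c : R42) : dot (a - b) c = dot a c - dot b c := by
  simp only [dot, Pi.sub_apply]; ring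

lemma dot_sub_right (a b c : R42) : dot a (b - c) = dot a b - dot a c := by
  simp only [dot, Pi.sub_apply]; ring

lemma dot_smul_left (r : ℝ) (a b : R42) : dot (r • a) b = r * dot a b := by
  simp only [dot, Pi.smul_apply, smul_eq_mul]; ring

lemma dot_smul_right (r : ℝ) (a b : R42) : dot a (r • b) = r * dot a b := by
  simp only [dot, Pi.smul_apply, smul_eq_mul]; ring

lemma dot_neg_left (a b : R42) : dot (-a) b = -dot a b := by
  simp only [dot, Pi.neg_apply]; ring

lemma dot_neg_right (a b : R42) : dot a (-b) = -dot a b := by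
  simp only [dot, Pi.neg_apply]; ring

lemma dot_zero_left (a : R42) : dot 0 a = 0 := by simp [dot]

lemma dot_zero_right (a : R42) : dot a 0 = 0 := by simp [dot]

lemma eq_zero_of_forall_dot {a : R42} (h : ∀ w, dot a w = 0) : a = 0 := by
  ext i
  have := h (Pi.single i 1)
  fin_cases i <;> simpa [dot] using this

/-- The determinant of four vectors of `ℝ⁴₂`. -/
def det4 (a b c d : R42) : ℝ := (Matrix.of ![a, b, c, d]).det

lemma det4_eq (a b c d : R42) : det4 a b c d =
    a 0 * (b 1 * (c 2 * d 3 - c 3 * d 2) - b 2 * (c 1 * d 3 - c 3 * d 1)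
      + b 3 * (c 1 * d 2 - c 2 * d 1))
    - a 1 * (b 0 * (c 2 * d 3 - c 3 * d 2) - b 2 * (c 0 * d 3 - c 3 * d 0)
      + b 3 * (c 0 * d 2 - c 2 * d 0))
    + a 2 * (b 0 * (c 1 * d 3 - c 3 * d 1) - b 1 * (c 0 * d 3 - c 3 * d 0)
      + b 3 * (c 0 * d 1 - c 1 * d 0))
    - a 3 * (b 0 * (c 1 * d 2 - c 2 * d 1) - b 1 * (c 0 * d 2 - c 2 * d 0)
      + b 2 * (c 0 * d 1 - c 1 * d 0)) := by
  simp [det4, Matrix.det_succ_row_zero, Fin.sum_univ_succ, Fin.succAbove]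
  ring

/-- The vector product of three vectors of `ℝ⁴₂`. -/
def cross (a b c : R42) : R42 :=
  ![-det4 a b c (Pi.single 0 1), det4 a b c (Pi.single 1 1), -det4 a b c (Pi.single 2 1),
    det4 a b c (Pi.single 3 1)]

/-- The signs in `cross` are those of the metric, which makes it dual to the determinant. -/
lemma dot_cross (a b c w : R42) : dot (cross a b c) w = det4 a b c w := by
  simp only [dot, cross, det4_eq]
  simp
  ring

lemma dot_cross_first (a b c : R42) : dot (cross a b c) a = 0 := by
  rw [dot_cross, det4_eq]; ring

lemma dot_cross_second (a b c : R42) : dot (cross a b c) b = 0 := by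
  rw [dot_cross, det4_eq]; ring

lemma dot_cross_third (a b c : R42) : dot (cross a b c) c = 0 := by
  rw [dot_cross, det4_eq]; ring

/-- Gram determinant; no sign appears because the metric diag(-1, 1, -1, 1) has determinant 1. -/
lemma det4_mul_det4 (a b c d a' b' c' d' : R42) :
    det4 a b c d * det4 a' b' c' d' =
      det4 ![dot a a', dot a b', dot a c', dot a d'] ![dot b a', dot b b', dot b c', dot b d']
        ![dot c a', dot c b', dot c c', dot c d'] ![dot d a', dot d b', dot d c', dot d d'] := by
  have key : Matrix.of ![![dot a a', dot a b', dot a c', dot a d'],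
      ![dot b a', dot b b', dot b c', dot b d'],
      ![dot c a', dot c b', dot c c', dot c d'], ![dot d a', dot d b', dot d c', dot d d']] =
      Matrix.of ![a, b, c, d] * Matrix.diagonal ![-1, 1, -1, 1] *
        (Matrix.of ![a', b', c', d']).transpose := by
    ext i j
    fin_cases i <;> fin_cases j <;>
      simp [Matrix.mul_apply, Fin.sum_univ_four, dot, Matrix.vecMul_diagonal] <;> ring
  conv_rhs => rw [det4, key]
  rw [Matrix.det_mul, Matrix.det_mul, Matrix.det_transpose, Matrix.det_diagonal]
  simp [det4, Fin.prod_univ_four]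

lemma det4_mulVec (A : Matrix (Fin 4) (Fin 4) ℝ) (a b c d : R42) :
    det4 (A.mulVec a) (A.mulVec b) (A.mulVec c) (A.mulVec d) = A.det * det4 a b c d := by
  have : Matrix.of ![A.mulVec a, A.mulVec b, A.mulVec c, A.mulVec d] =
      Matrix.of ![a, b, c, d] * A.transpose := by
    ext i j
    fin_cases i <;> simp [Matrix.mul_apply, Matrix.mulVec, dotProduct, mul_comm]
  rw [det4, this, Matrix.det_mul, Matrix.det_transpose, mul_comm]
  rfl

lemma dot_cross_self (a b c : R42) : dot (cross a b c) (cross a b c) =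
    dot a a * (dot b b * dot c c - dot b c ^ 2) - dot a b * (dot a b * dot c c - dot b c * dot a c)
      + dot a c * (dot a b * dot b c - dot b b * dot a c) := by
  simp only [dot, cross, det4_eq]
  simp
  ring

/-- A vector orthogonal to four linearly independent vectors vanishes. -/
lemma eq_zero_of_dot_eq_zero {a b c d w : R42} (hd : det4 a b c d ≠ 0) (ha : dot w a = 0)
    (hb : dot w b = 0) (hc : dot w c = 0) (hw : dot w d = 0) : w = 0 := by
  refine eq_zero_of_forall_dot fun w' => ?_
  -- The mixed Gram determinant has a zero first row. With basis vectors for i, j, k the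
  -- determinants are, up to sign, the coordinates of `w`.
  have h (i j k : R42) : det4 w i j k * det4 a b c d = 0 := by
    rw [det4_mul_det4, ha, hb, hc, hw, det4_eq]
    simp
  have h' : ∀ i j k, det4 w i j k = 0 := fun i j k => (mul_eq_zero.1 (h i j k)).resolve_right hd
  have h0 := h' (Pi.single 1 1) (Pi.single 2 1) (Pi.single 3 1)
  have h1 := h' (Pi.single 0 1) (Pi.single 2 1) (Pi.single 3 1)
  have h2 := h' (Pi.single 0 1) (Pi.single 1 1) (Pi.single 3 1)
  have h3 := h' (Pi.single 0 1) (Pi.single 1 1) (Pi.single 2 1)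
  simp [det4_eq] at h0 h1 h2 h3
  simp [dot, h0, h1, h2, h3]

end Algebra

/-! ### Null coordinates and null frames -/

/-- The null coordinate `u + v`. -/
def sig : Plane →L[ℝ] ℝ := ContinuousLinearMap.fst ℝ ℝ ℝ + ContinuousLinearMap.snd ℝ ℝ ℝ

/-- The null coordinate `u - v`. -/
def tau : Plane →L[ℝ] ℝ := ContinuousLinearMap.fst ℝ ℝ ℝ - ContinuousLinearMap.snd ℝ ℝ ℝ

@[simp] lemma sig_apply (c : Plane) : sig c = c.1 + c.2 := rfl

@[simp] lemma tau_apply (c : Plane) : tau c = c.1 - c.2 := rfl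

/-- The scalar product of `ℝ⁴₂` as a continuous bilinear map. -/
noncomputable def dotL : R42 →L[ℝ] R42 →L[ℝ] ℝ :=
  (LinearMap.mk₂ ℝ dot dot_add_left dot_smul_left dot_add_right
    dot_smul_right).toContinuousBilinearMap

@[simp] lemma dotL_apply (a b : R42) : dotL a b = dot a b := rfl

/-! ### Derivatives of scalar products and of functions of one linear coordinate. -/

section Calculus

variable {E F : Type*} [NormedAddCommGroup E] [NormedSpace ℝ E] [NormedAddCommGroup F]
  [NormedSpace ℝ F]

lemma hasFDerivAt_dot {f g : E → R42} {f' g' : E →L[ℝ] R42} {p : E} (hf : HasFDerivAt f f' p)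
    (hg : HasFDerivAt g g' p) :
    HasFDerivAt (fun q => dot (f q) (g q)) (dotL (f p) ∘L g' + dotL.flip (g p) ∘L f') p :=
  (dotL.hasFDerivAt_of_bilinear hf hg).congr_fderiv (by ext; simp)

lemma fderiv_dot_apply {f g : E → R42} {f' g' : E →L[ℝ] R42} {p : E} (hf : HasFDerivAt f f' p)
    (hg : HasFDerivAt g g' p) (c : E) :
    fderiv ℝ (fun q => dot (f q) (g q)) p c = dot (f p) (g' c) + dot (f' c) (g p) := by
  rw [(hasFDerivAt_dot hf hg).fderiv]
  simp

lemma contDiffOn_fderiv_apply {f : E → F} {W : Set E} (hW : IsOpen W) (hf : ContDiffOn ℝ ∞ f W)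
    (c : E) : ContDiffOn ℝ ∞ (fun q => fderiv ℝ f q c) W :=
  (hf.fderiv_of_isOpen hW (by simp)).clm_apply contDiffOn_const

lemma differentiableAt_of_contDiffOn {f : E → F} {W : Set E} (hW : IsOpen W)
    (hf : ContDiffOn ℝ ∞ f W) {p : E} (hp : p ∈ W) : DifferentiableAt ℝ f p :=
  (hf.contDiffAt (hW.mem_nhds hp)).differentiableAt (by simp)

lemma fderiv_fderiv_comm {f : E → F} {W : Set E} (hW : IsOpen W) (hf : ContDiffOn ℝ ∞ f W)
    {p : E} (hp : p ∈ W) (c d : E) :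
    fderiv ℝ (fun q => fderiv ℝ f q d) p c = fderiv ℝ (fun q => fderiv ℝ f q c) p d := by
  have h := (hf.contDiffAt (hW.mem_nhds hp)).isSymmSndFDerivAt
    (by rw [minSmoothness_of_isRCLikeNormedField]; exact WithTop.coe_le_coe.2 le_top)
  have hd : DifferentiableAt ℝ (fderiv ℝ f) p :=
    differentiableAt_of_contDiffOn hW (hf.fderiv_of_isOpen hW (by simp)) hp
  rw [fderiv_clm_apply hd (differentiableAt_const _), fderiv_clm_apply hd (differentiableAt_const _)]
  simpa using h c d

/-- If a smooth function depends only on the linear coordinate `ℓ`, then so does its derivative. -/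
lemma hasFDerivAt_of_hasFDerivAt_smulRight {ℓ : E →L[ℝ] ℝ} {e : E} (he : ℓ e = 1) {g g₁ : E → F}
    {W : Set E} (hW : IsOpen W) (hg : ContDiffOn ℝ ∞ g W)
    (h : ∀ p ∈ W, HasFDerivAt g (ℓ.smulRight (g₁ p)) p) :
    ContDiffOn ℝ ∞ g₁ W ∧ ∀ p ∈ W, HasFDerivAt g₁ (ℓ.smulRight (fderiv ℝ g₁ p e)) p := by
  have h1 : ∀ c, ∀ p ∈ W, fderiv ℝ g p c = ℓ c • g₁ p := fun c p hp => by
    rw [(h p hp).fderiv]; simp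
  have hs : ContDiffOn ℝ ∞ g₁ W :=
    (contDiffOn_fderiv_apply hW hg e).congr fun p hp => by rw [h1 e p hp, he, one_smul]
  refine ⟨hs, fun p hp => ?_⟩
  have hd := differentiableAt_of_contDiffOn hW hs hp
  convert hd.hasFDerivAt using 1
  ext c
  have hc : ∀ c, (fun q => fderiv ℝ g q c) =ᶠ[nhds p] fun q => ℓ c • g₁ q := fun c => by
    filter_upwards [hW.mem_nhds hp] with q hq using h1 c q hq
  -- Since ∂_c g = ℓ(c) g₁ and ℓ(e) = 1, symmetry of the second derivative reads ∂_c g₁ = ℓ(c) ∂_e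
  -- g₁.
  have := fderiv_fderiv_comm hW hg hp c e
  rw [(hc e).fderiv_eq, (hc c).fderiv_eq, fderiv_fun_const_smul hd, fderiv_fun_const_smul hd] at this
  simpa [he] using this.symm

end Calculus

/-- `x` is a minimal time-like isothermal map on the open set `W`, with `dx = a dσ + b dτ` in the
null coordinates `σ = u + v`, `τ = u - v`, where `a` depends only on `σ`, `b` only on `τ`, and `a₁`,
`b₁` are their derivatives. -/
structure IsNullFrame (x a b a₁ b₁ : Plane → R42) (W : Set Plane) : Prop where
  isOpen : IsOpen W
  contDiffOn : ContDiffOn ℝ ∞ x W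
  hasFDerivAt : ∀ p ∈ W, HasFDerivAt x (sig.smulRight (a p) + tau.smulRight (b p)) p
  hasFDerivAt_a : ∀ p ∈ W, HasFDerivAt a (sig.smulRight (a₁ p)) p
  hasFDerivAt_b : ∀ p ∈ W, HasFDerivAt b (tau.smulRight (b₁ p)) p
  dot_a_a : ∀ p ∈ W, dot (a p) (a p) = 0
  dot_b_b : ∀ p ∈ W, dot (b p) (b p) = 0
  dot_a_b : ∀ p ∈ W, dot (a p) (b p) < 0

namespace IsNullFrame

variable {x a b a₁ b₁ : Plane → R42} {W : Set Plane}

lemma mono (h : IsNullFrame x a b a₁ b₁ W) {V : Set Plane} (hV : IsOpen V) (hVW : V ⊆ W) :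
    IsNullFrame x a b a₁ b₁ V :=
  ⟨hV, h.contDiffOn.mono hVW, fun p hp => h.hasFDerivAt p (hVW hp),
    fun p hp => h.hasFDerivAt_a p (hVW hp), fun p hp => h.hasFDerivAt_b p (hVW hp),
    fun p hp => h.dot_a_a p (hVW hp), fun p hp => h.dot_b_b p (hVW hp),
    fun p hp => h.dot_a_b p (hVW hp)⟩

lemma fderiv_apply (h : IsNullFrame x a b a₁ b₁ W) {p : Plane} (hp : p ∈ W) (c : Plane) :
    fderiv ℝ x p c = (c.1 + c.2) • a p + (c.1 - c.2) • b p := by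
  rw [(h.hasFDerivAt p hp).fderiv]; simp

lemma contDiffOn_a (h : IsNullFrame x a b a₁ b₁ W) : ContDiffOn ℝ ∞ a W :=
  -- In this direction σ = 1 and τ = 0, so the derivative of `x` is `a`.
  (contDiffOn_fderiv_apply h.isOpen h.contDiffOn (1 / 2, 1 / 2)).congr fun p hp => by
    rw [h.fderiv_apply hp]; norm_num

lemma contDiffOn_b (h : IsNullFrame x a b a₁ b₁ W) : ContDiffOn ℝ ∞ b W :=
  (contDiffOn_fderiv_apply h.isOpen h.contDiffOn (1 / 2, -1 / 2)).congr fun p hp => by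
    rw [h.fderiv_apply hp]; norm_num

lemma hasFDerivAt_a₁ (h : IsNullFrame x a b a₁ b₁ W) :
    ∃ a₂ : Plane → R42, ∀ p ∈ W, HasFDerivAt a₁ (sig.smulRight (a₂ p)) p :=
  ⟨_, (hasFDerivAt_of_hasFDerivAt_smulRight (e := ((1 : ℝ), (0 : ℝ))) (by simp) h.isOpen
    h.contDiffOn_a h.hasFDerivAt_a).2⟩

lemma hasFDerivAt_b₁ (h : IsNullFrame x a b a₁ b₁ W) :
    ∃ b₂ : Plane → R42, ∀ p ∈ W, HasFDerivAt b₁ (tau.smulRight (b₂ p)) p :=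
  ⟨_, (hasFDerivAt_of_hasFDerivAt_smulRight (e := ((1 : ℝ), (0 : ℝ))) (by simp) h.isOpen
    h.contDiffOn_b h.hasFDerivAt_b).2⟩

lemma dot_a_a₁ (h : IsNullFrame x a b a₁ b₁ W) {p : Plane} (hp : p ∈ W) :
    dot (a p) (a₁ p) = 0 := by
  have h1 := fderiv_dot_apply (h.hasFDerivAt_a p hp) (h.hasFDerivAt_a p hp) (1, 0)
  have h2 : (fun q => dot (a q) (a q)) =ᶠ[nhds p] fun _ => 0 := by
    filter_upwards [h.isOpen.mem_nhds hp] with q hq using h.dot_a_a q hq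
  rw [h2.fderiv_eq] at h1
  simp [dot_comm (a₁ p)] at h1
  linarith

lemma dot_b_b₁ (h : IsNullFrame x a b a₁ b₁ W) {p : Plane} (hp : p ∈ W) :
    dot (b p) (b₁ p) = 0 := by
  have h1 := fderiv_dot_apply (h.hasFDerivAt_b p hp) (h.hasFDerivAt_b p hp) (1, 0)
  have h2 : (fun q => dot (b q) (b q)) =ᶠ[nhds p] fun _ => 0 := by
    filter_upwards [h.isOpen.mem_nhds hp] with q hq using h.dot_b_b q hq
  rw [h2.fderiv_eq] at h1
  simp [dot_comm (b₁ p)] at h1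
  linarith

lemma du_eq (h : IsNullFrame x a b a₁ b₁ W) {p : Plane} (hp : p ∈ W) : du x p = a p + b p := by
  rw [du, h.fderiv_apply hp]; simp

lemma dv_eq (h : IsNullFrame x a b a₁ b₁ W) {p : Plane} (hp : p ∈ W) : dv x p = a p - b p := by
  rw [dv, h.fderiv_apply hp]; simp [sub_eq_add_neg]

lemma coeffE_eq (h : IsNullFrame x a b a₁ b₁ W) {p : Plane} (hp : p ∈ W) :
    coeffE x p = 2 * dot (a p) (b p) := by
  simp only [coeffE, h.du_eq hp, dot_add_left, dot_add_right, h.dot_a_a p hp, h.dot_b_b p hp,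
    dot_comm (b p) (a p)]
  ring

lemma coeffG_eq (h : IsNullFrame x a b a₁ b₁ W) {p : Plane} (hp : p ∈ W) :
    coeffG x p = -(2 * dot (a p) (b p)) := by
  simp only [coeffG, h.dv_eq hp, dot_sub_left, dot_sub_right, h.dot_a_a p hp, h.dot_b_b p hp,
    dot_comm (b p) (a p)]
  ring

lemma coeffF_eq (h : IsNullFrame x a b a₁ b₁ W) {p : Plane} (hp : p ∈ W) : coeffF x p = 0 := by
  simp only [coeffF, h.du_eq hp, h.dv_eq hp, dot_add_left, dot_sub_right, h.dot_a_a p hp,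
    h.dot_b_b p hp, dot_comm (b p) (a p)]
  ring

lemma dot_fderiv_fderiv (h : IsNullFrame x a b a₁ b₁ W) {p : Plane} (hp : p ∈ W) (c d : Plane) :
    dot (fderiv ℝ x p c) (fderiv ℝ x p d) =
      ((c.1 + c.2) * (d.1 - d.2) + (c.1 - c.2) * (d.1 + d.2)) * dot (a p) (b p) := by
  simp only [h.fderiv_apply hp, dot_add_left, dot_add_right, dot_smul_left, dot_smul_right,
    h.dot_a_a p hp, h.dot_b_b p hp, dot_comm (b p) (a p)]
  ring

lemma tangentProj_eq (h : IsNullFrame x a b a₁ b₁ W) {p : Plane} (hp : p ∈ W) (w : R42) :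
    tangentProj x p w = (dot w (b p) / dot (a p) (b p)) • a p +
      (dot w (a p) / dot (a p) (b p)) • b p := by
  have h0 := (h.dot_a_b p hp).ne
  rw [tangentProj, h.coeffE_eq hp, h.coeffF_eq hp, h.coeffG_eq hp, h.du_eq hp, h.dv_eq hp]
  simp only [dot_add_right, dot_sub_right]
  ext i
  simp only [Pi.smul_apply, Pi.add_apply, Pi.sub_apply, smul_eq_mul]
  field_simp
  ring

lemma normalProj_eq (h : IsNullFrame x a b a₁ b₁ W) {p : Plane} (hp : p ∈ W) (w : R42) :
    normalProj x p w = w - ((dot w (b p) / dot (a p) (b p)) • a p +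
      (dot w (a p) / dot (a p) (b p)) • b p) := by
  rw [normalProj, h.tangentProj_eq hp]

lemma hasFDerivAt_fderiv_apply (h : IsNullFrame x a b a₁ b₁ W) {p : Plane} (hp : p ∈ W)
    (c : Plane) : HasFDerivAt (fun q => fderiv ℝ x q c)
      ((c.1 + c.2) • sig.smulRight (a₁ p) + (c.1 - c.2) • tau.smulRight (b₁ p)) p := by
  refine (((h.hasFDerivAt_a p hp).const_smul (c.1 + c.2)).add
    ((h.hasFDerivAt_b p hp).const_smul (c.1 - c.2))).congr_of_eventuallyEq ?_
  filter_upwards [h.isOpen.mem_nhds hp] with q hq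
  rw [h.fderiv_apply hq]; rfl

/-- There is no mixed term, because a is constant along τ and b along σ. -/
lemma secondForm_eq (h : IsNullFrame x a b a₁ b₁ W) {p : Plane} (hp : p ∈ W) (c d : Plane) :
    secondForm x p c d = normalProj x p (((d.1 + d.2) * (c.1 + c.2)) • a₁ p +
      ((d.1 - d.2) * (c.1 - c.2)) • b₁ p) := by
  rw [secondForm, (h.hasFDerivAt_fderiv_apply hp d).fderiv]
  simp [mul_smul]

end IsNullFrame

/-- With F = 0 and G = -E the mean curvature vector is a multiple of σ(∂_u, ∂_u) - σ(∂_v, ∂_v),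
where σ is the second fundamental form; both terms are the normal part of a₁ + b₁. -/
lemma isMinimal_of_isNullFrame {M : Patch} {a b a₁ b₁ : Plane → R42}
    (h : IsNullFrame M.map a b a₁ b₁ M.domain) : IsMinimal M where
  isOpen := h.isOpen
  contDiffOn := h.contDiffOn
  E_eq_neg_G p hp := by rw [h.coeffE_eq hp, h.coeffG_eq hp, neg_neg]
  F_eq_zero p hp := h.coeffF_eq hp
  E_neg p hp := by rw [h.coeffE_eq hp]; linarith [h.dot_a_b p hp]
  meanCurvature_eq_zero p hp := by
    rw [meanCurvature, h.coeffE_eq hp, h.coeffG_eq hp, h.coeffF_eq hp, h.secondForm_eq hp,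
      h.secondForm_eq hp, h.secondForm_eq hp]
    simp

/-- In isothermal coordinates, a minimal surface satisfies the wave equation. -/
lemma IsMinimal.du_du_eq_dv_dv {M : Patch} (h : IsMinimal M) {p : Plane} (hp : p ∈ M.domain) :
    du (du M.map) p = dv (dv M.map) p := by
  set x := M.map
  have hsm (c : Plane) := contDiffOn_fderiv_apply h.isOpen h.contDiffOn c
  have hd (c : Plane) := (differentiableAt_of_contDiffOn h.isOpen (hsm c) hp).hasFDerivAt
  have hsymm := fderiv_fderiv_comm h.isOpen h.contDiffOn hp (1, 0) (0, 1)
  have hE := h.E_eq_neg_G p hp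
  have hF := h.F_eq_zero p hp
  have hEn := h.E_neg p hp
  have hG : coeffG x p = -coeffE x p := by rw [hE, neg_neg]
  have dE (c : Plane) : fderiv ℝ (coeffE x) p c = _ := fderiv_dot_apply (hd (1, 0)) (hd (1, 0)) c
  have dF (c : Plane) : fderiv ℝ (coeffF x) p c = _ := fderiv_dot_apply (hd (1, 0)) (hd (0, 1)) c
  have dG (c : Plane) : fderiv ℝ (coeffG x) p c = _ := fderiv_dot_apply (hd (0, 1)) (hd (0, 1)) c
  have eEG : coeffE x =ᶠ[nhds p] fun q => -coeffG x q := by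
    filter_upwards [h.isOpen.mem_nhds hp] with q hq using h.E_eq_neg_G q hq
  have eF : coeffF x =ᶠ[nhds p] fun q => 0 := by
    filter_upwards [h.isOpen.mem_nhds hp] with q hq using h.F_eq_zero q hq
  have dEG (c : Plane) : fderiv ℝ (coeffE x) p c = -fderiv ℝ (coeffG x) p c := by
    rw [eEG.fderiv_eq, fderiv_fun_neg]; rfl
  have dF0 (c : Plane) : fderiv ℝ (coeffF x) p c = 0 := by
    rw [eF.fderiv_eq]; simp
  have e1 := dEG (1, 0)
  have e2 := dEG (0, 1)
  have e3 := dF0 (1, 0)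
  have e4 := dF0 (0, 1)
  rw [dE, dG] at e1 e2
  rw [dF] at e3 e4
  have hmean := h.meanCurvature_eq_zero p hp
  rw [meanCurvature, hF, hG] at hmean
  change fderiv ℝ (fun q => fderiv ℝ x q (1, 0)) p (1, 0) =
    fderiv ℝ (fun q => fderiv ℝ x q (0, 1)) p (0, 1)
  simp only [secondForm] at hmean
  rw [← hsymm] at e2 e4
  set xuu := fderiv ℝ (fun q => fderiv ℝ x q (1, 0)) p (1, 0)
  set xvv := fderiv ℝ (fun q => fderiv ℝ x q (0, 1)) p (0, 1)
  set xuv := fderiv ℝ (fun q => fderiv ℝ x q (0, 1)) p (1, 0)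
  -- The tangential part of x_uu - x_vv vanishes by differentiating E = -G and F = 0; the normal
  -- part vanishes by minimality.
  have o1 : dot (xuu - xvv) (du x p) = 0 := by
    rw [dot_sub_left, du]
    rw [dot_comm _ xuu, dot_comm _ xuv] at e1
    rw [dot_comm _ xvv] at e4
    linarith
  have o2 : dot (xuu - xvv) (dv x p) = 0 := by
    rw [dot_sub_left, dv]
    rw [dot_comm _ xuv, dot_comm _ xvv] at e2
    rw [dot_comm _ xuv] at e3
    linarith
  have hn : normalProj x p xuu - normalProj x p xvv = 0 := by
    have : (1 / 2 : ℝ) * (coeffE x p * -coeffE x p - 0 ^ 2)⁻¹ * -coeffE x p ≠ 0 := by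
      have h0 : coeffE x p ≠ 0 := hEn.ne
      simp [h0]
    refine (smul_eq_zero.1 ?_).resolve_left this
    rw [← hmean]
    module
  have hn2 : normalProj x p xuu - normalProj x p xvv = xuu - xvv := by
    have : normalProj x p xuu - normalProj x p xvv = normalProj x p (xuu - xvv) := by
      simp only [normalProj, tangentProj, dot_sub_left]
      module
    rw [this, normalProj, tangentProj, o1, o2]
    simp
  rw [hn2] at hn
  exact sub_eq_zero.1 hn

/-- Take a = (x_u + x_v)/2 and b = (x_u - x_v)/2. The wave equation and x_uv = x_vu give a_v = a_u
and b_v = -b_u. -/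
lemma IsMinimal.exists_isNullFrame {M : Patch} (h : IsMinimal M) :
    ∃ a b a₁ b₁, IsNullFrame M.map a b a₁ b₁ M.domain := by
  set x := M.map with hx
  have hsm (c : Plane) := contDiffOn_fderiv_apply h.isOpen h.contDiffOn c
  have hd (c p : Plane) (hp : p ∈ M.domain) :=
    differentiableAt_of_contDiffOn h.isOpen (hsm c) hp
  set a : Plane → R42 := fun q => (1 / 2 : ℝ) • (du x q + dv x q) with ha
  set b : Plane → R42 := fun q => (1 / 2 : ℝ) • (du x q - dv x q) with hb
  have split (f : Plane →L[ℝ] R42) (c : Plane) : f c = c.1 • f (1, 0) + c.2 • f (0, 1) := by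
    rw [← map_smul, ← map_smul, ← map_add]; simp
  have hE (p) (hp : p ∈ M.domain) : dot (du x p) (du x p) = -dot (dv x p) (dv x p) :=
    h.E_eq_neg_G p hp
  have hF (p) (hp : p ∈ M.domain) : dot (du x p) (dv x p) = 0 := h.F_eq_zero p hp
  have hneg (p) (hp : p ∈ M.domain) : dot (du x p) (du x p) < 0 := h.E_neg p hp
  have hsymm (p) (hp : p ∈ M.domain) : du (dv x) p = dv (du x) p :=
    fderiv_fderiv_comm h.isOpen h.contDiffOn hp (1, 0) (0, 1)
  have hwave (p) (hp : p ∈ M.domain) := h.du_du_eq_dv_dv hp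
  have hda (p) (hp : p ∈ M.domain) :
      HasFDerivAt a ((1 / 2 : ℝ) • (fderiv ℝ (du x) p + fderiv ℝ (dv x) p)) p :=
    ((hd (1, 0) p hp).hasFDerivAt.add (hd (0, 1) p hp).hasFDerivAt).const_smul (1 / 2 : ℝ)
  have hdb (p) (hp : p ∈ M.domain) :
      HasFDerivAt b ((1 / 2 : ℝ) • (fderiv ℝ (du x) p - fderiv ℝ (dv x) p)) p :=
    ((hd (1, 0) p hp).hasFDerivAt.sub (hd (0, 1) p hp).hasFDerivAt).const_smul (1 / 2 : ℝ)
  refine ⟨a, b, du a, du b, h.isOpen, h.contDiffOn, fun p hp => ?_, fun p hp => ?_, fun p hp => ?_,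
    fun p hp => ?_, fun p hp => ?_, fun p hp => ?_⟩
  · refine (differentiableAt_of_contDiffOn h.isOpen h.contDiffOn hp).hasFDerivAt.congr_fderiv ?_
    refine ContinuousLinearMap.ext fun c => ?_
    rw [split (fderiv ℝ x p) c]
    simp only [ha, hb, du, dv, _root_.add_apply, ContinuousLinearMap.smulRight_apply,
      sig_apply, tau_apply]
    module
  · refine (hda p hp).differentiableAt.hasFDerivAt.congr_fderiv ?_
    refine ContinuousLinearMap.ext fun c => ?_
    have : fderiv ℝ a p (0, 1) = fderiv ℝ a p (1, 0) := by
      rw [(hda p hp).fderiv]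
      have h1 := hsymm p hp
      have h2 := hwave p hp
      simp only [du, dv, _root_.smul_apply, _root_.add_apply] at h1 h2 ⊢
      rw [h1, h2, add_comm]
    rw [split (fderiv ℝ a p) c, this]
    simp [du, add_smul]
  · refine (hdb p hp).differentiableAt.hasFDerivAt.congr_fderiv ?_
    refine ContinuousLinearMap.ext fun c => ?_
    have : fderiv ℝ b p (0, 1) = -fderiv ℝ b p (1, 0) := by
      rw [(hdb p hp).fderiv]
      have h1 := hsymm p hp
      have h2 := hwave p hp
      simp only [du, dv, _root_.smul_apply, _root_.sub_apply] at h1 h2 ⊢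
      rw [h1, h2]
      module
    rw [split (fderiv ℝ b p) c, this]
    simp only [du, ContinuousLinearMap.smulRight_apply, tau_apply]
    module
  · simp only [ha, dot_smul_left, dot_smul_right, dot_add_left, dot_add_right, hE p hp, hF p hp,
      dot_comm (dv x p) (du x p)]
    ring
  · simp only [hb, dot_smul_left, dot_smul_right, dot_sub_left, dot_sub_right, hE p hp, hF p hp,
      dot_comm (dv x p) (du x p)]
    ring
  · have := hneg p hp
    have h2 := hE p hp
    simp only [ha, hb, dot_smul_left, dot_smul_right, dot_sub_right, dot_add_left, hF p hp,
      dot_comm (dv x p) (du x p)]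
    linarith

/-! ### The curvature of the normal connection -/

lemma normalProj_add (x : Plane → R42) (p : Plane) (w w' : R42) :
    normalProj x p (w + w') = normalProj x p w + normalProj x p w' := by
  simp only [normalProj, tangentProj, dot_add_left]
  module

lemma normalProj_smul (x : Plane → R42) (p : Plane) (r : ℝ) (w : R42) :
    normalProj x p (r • w) = r • normalProj x p w := by
  simp only [normalProj, tangentProj, dot_smul_left]
  module

lemma normalProj_neg (x : Plane → R42) (p : Plane) (w : R42) :
    normalProj x p (-w) = -normalProj x p w := by
  simpa using normalProj_smul x p (-1) w

/-- Where the coefficient vanishes, the derivative of the vector factor does not enter. This avoids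
differentiating normal projections in the curvature computation. -/
lemma hasFDerivAt_smul_of_eq_zero {E F : Type*} [NormedAddCommGroup E] [NormedSpace ℝ E]
    [NormedAddCommGroup F] [NormedSpace ℝ F] {f : E → ℝ} {f' : E →L[ℝ] ℝ} {g : E → F} {p : E}
    (hf : HasFDerivAt f f' p) (hg : DifferentiableAt ℝ g p) (h0 : f p = 0) :
    HasFDerivAt (fun q => f q • g q) (f'.smulRight (g p)) p :=
  (hf.fun_smul hg.hasFDerivAt).congr_fderiv (by simp [h0])

lemma differentiableAt_dot {E : Type*} [NormedAddCommGroup E] [NormedSpace ℝ E] {f g : E → R42}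
    {p : E} (hf : DifferentiableAt ℝ f p) (hg : DifferentiableAt ℝ g p) :
    DifferentiableAt ℝ (fun q => dot (f q) (g q)) p :=
  (hasFDerivAt_dot hf.hasFDerivAt hg.hasFDerivAt).differentiableAt

lemma differentiableAt_fun_div {E : Type*} [NormedAddCommGroup E] [NormedSpace ℝ E] {f g : E → ℝ}
    {p : E} (hf : DifferentiableAt ℝ f p) (hg : DifferentiableAt ℝ g p) (h0 : g p ≠ 0) :
    DifferentiableAt ℝ (fun q => f q / g q) p := by
  simpa only [div_eq_mul_inv] using hf.fun_mul (hg.fun_inv h0)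

namespace IsNullFrame

variable {x a b a₁ b₁ : Plane → R42} {W : Set Plane} {p : Plane}

lemma normalProj_a (h : IsNullFrame x a b a₁ b₁ W) (hp : p ∈ W) : normalProj x p (a p) = 0 := by
  rw [h.normalProj_eq hp, h.dot_a_a p hp, div_self (h.dot_a_b p hp).ne]
  simp

lemma normalProj_b (h : IsNullFrame x a b a₁ b₁ W) (hp : p ∈ W) : normalProj x p (b p) = 0 := by
  rw [h.normalProj_eq hp, h.dot_b_b p hp, dot_comm (b p), div_self (h.dot_a_b p hp).ne]
  simp

lemma normalProj_normalProj (h : IsNullFrame x a b a₁ b₁ W) (hp : p ∈ W) (w : R42) :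
    normalProj x p (normalProj x p w) = normalProj x p w := by
  conv_lhs => rw [h.normalProj_eq hp w]
  rw [sub_eq_add_neg, normalProj_add, normalProj_neg, normalProj_add, normalProj_smul,
    normalProj_smul, h.normalProj_a hp, h.normalProj_b hp]
  simp

lemma dot_normalProj (h : IsNullFrame x a b a₁ b₁ W) (hp : p ∈ W) (w : R42) {n : R42}
    (hna : dot n (a p) = 0) (hnb : dot n (b p) = 0) : dot (normalProj x p w) n = dot w n := by
  rw [h.normalProj_eq hp, dot_sub_left, dot_add_left, dot_smul_left, dot_smul_left, dot_comm (a p) n,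
    dot_comm (b p) n, hna, hnb]
  ring

lemma differentiableAt_a (h : IsNullFrame x a b a₁ b₁ W) (hp : p ∈ W) : DifferentiableAt ℝ a p :=
  (h.hasFDerivAt_a p hp).differentiableAt

lemma differentiableAt_b (h : IsNullFrame x a b a₁ b₁ W) (hp : p ∈ W) : DifferentiableAt ℝ b p :=
  (h.hasFDerivAt_b p hp).differentiableAt

lemma differentiableAt_a₁ (h : IsNullFrame x a b a₁ b₁ W) (hp : p ∈ W) :
    DifferentiableAt ℝ a₁ p :=
  (h.hasFDerivAt_a₁.choose_spec p hp).differentiableAt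

lemma differentiableAt_b₁ (h : IsNullFrame x a b a₁ b₁ W) (hp : p ∈ W) :
    DifferentiableAt ℝ b₁ p :=
  (h.hasFDerivAt_b₁.choose_spec p hp).differentiableAt

lemma differentiableAt_normalProj (h : IsNullFrame x a b a₁ b₁ W) (hp : p ∈ W) {w : Plane → R42}
    (hw : DifferentiableAt ℝ w p) : DifferentiableAt ℝ (fun q => normalProj x q (w q)) p := by
  have ha := h.differentiableAt_a hp
  have hb := h.differentiableAt_b hp
  have hab := differentiableAt_dot ha hb
  have h0 := (h.dot_a_b p hp).ne
  have hα : DifferentiableAt ℝ (fun q => dot (w q) (b q) / dot (a q) (b q)) p :=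
    differentiableAt_fun_div (f := fun q => dot (w q) (b q)) (differentiableAt_dot hw hb) hab h0
  have hβ : DifferentiableAt ℝ (fun q => dot (w q) (a q) / dot (a q) (b q)) p :=
    differentiableAt_fun_div (f := fun q => dot (w q) (a q)) (differentiableAt_dot hw ha) hab h0
  have hd : DifferentiableAt ℝ (fun q => w q - ((dot (w q) (b q) / dot (a q) (b q)) • a q +
      (dot (w q) (a q) / dot (a q) (b q)) • b q)) p :=
    hw.fun_sub ((hα.fun_smul ha).fun_add (hβ.fun_smul hb))
  refine hd.congr_of_eventuallyEq ?_
  filter_upwards [h.isOpen.mem_nhds hp] with q hq using h.normalProj_eq hq _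

/-- The derivatives of the coefficients of a and b contribute only tangent vectors, which the
projection kills. The vector n is not required to be normal at p: the formula is needed at
neighboring points, to be differentiated again. -/
lemma normalDeriv_normalProj (h : IsNullFrame x a b a₁ b₁ W) (hp : p ∈ W) (n : R42) (c : Plane) :
    normalDeriv x c (fun q => normalProj x q n) p =
      -(dot n (b p) • ((c.1 + c.2) / dot (a p) (b p)) • normalProj x p (a₁ p) +
        dot n (a p) • ((c.1 - c.2) / dot (a p) (b p)) • normalProj x p (b₁ p)) := by
  have ha := h.differentiableAt_a hp
  have hb := h.differentiableAt_b hp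
  have hab := differentiableAt_dot ha hb
  have h0 := (h.dot_a_b p hp).ne
  have hn : DifferentiableAt ℝ (fun _ : Plane => n) p := differentiableAt_const n
  have hα : DifferentiableAt ℝ (fun q => dot n (b q) / dot (a q) (b q)) p :=
    differentiableAt_fun_div (f := fun q => dot n (b q)) (differentiableAt_dot hn hb) hab h0
  have hβ : DifferentiableAt ℝ (fun q => dot n (a q) / dot (a q) (b q)) p :=
    differentiableAt_fun_div (f := fun q => dot n (a q)) (differentiableAt_dot hn ha) hab h0
  have hd := ((hα.hasFDerivAt.fun_smul (h.hasFDerivAt_a p hp)).fun_add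
    (hβ.hasFDerivAt.fun_smul (h.hasFDerivAt_b p hp))).const_sub n
  have heq : (fun q => normalProj x q n) =ᶠ[nhds p] fun q =>
      n - ((dot n (b q) / dot (a q) (b q)) • a q + (dot n (a q) / dot (a q) (b q)) • b q) := by
    filter_upwards [h.isOpen.mem_nhds hp] with q hq using h.normalProj_eq hq _
  rw [normalDeriv, heq.fderiv_eq, hd.fderiv]
  simp only [_root_.neg_apply, _root_.add_apply, _root_.smul_apply,
    ContinuousLinearMap.smulRight_apply, normalProj_neg, normalProj_add, normalProj_smul,
    h.normalProj_a hp, h.normalProj_b hp, sig_apply, tau_apply]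
  module

/-- The first normal derivative of n^⊥ has the factors n · a and n · b, which vanish at p because n
is normal there. The second derivative therefore falls on these factors alone and produces n · a₁
and n · b₁. -/
lemma dot_normalCurvatureTensor (h : IsNullFrame x a b a₁ b₁ W) (hp : p ∈ W) (c d : Plane)
    {n n' : R42} (hna : dot n (a p) = 0) (hnb : dot n (b p) = 0) (hna' : dot n' (a p) = 0)
    (hnb' : dot n' (b p) = 0) : dot (normalCurvatureTensor x p c d n) n' =
      ((c.1 + c.2) * (d.1 - d.2) - (d.1 + d.2) * (c.1 - c.2)) / dot (a p) (b p) *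
        (dot n (b₁ p) * dot n' (a₁ p) - dot n (a₁ p) * dot n' (b₁ p)) := by
  have key (c d : Plane) : normalDeriv x c (normalDeriv x d fun q => normalProj x q n) p =
      -((((c.1 - c.2) * dot n (b₁ p)) * ((d.1 + d.2) / dot (a p) (b p))) • normalProj x p (a₁ p) +
        (((c.1 + c.2) * dot n (a₁ p)) * ((d.1 - d.2) / dot (a p) (b p))) •
          normalProj x p (b₁ p)) := by
    have ha := h.differentiableAt_a hp
    have hb := h.differentiableAt_b hp
    have hab := differentiableAt_dot ha hb
    have h0 := (h.dot_a_b p hp).ne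
    have hn : HasFDerivAt (fun _ : Plane => n) (0 : Plane →L[ℝ] R42) p :=
      hasFDerivAt_const n p
    have hP : DifferentiableAt ℝ (fun q => ((d.1 + d.2) / dot (a q) (b q)) •
        normalProj x q (a₁ q)) p :=
      (differentiableAt_fun_div (f := fun _ => d.1 + d.2) (differentiableAt_const _) hab h0).fun_smul
        (h.differentiableAt_normalProj hp (h.differentiableAt_a₁ hp))
    have hQ : DifferentiableAt ℝ (fun q => ((d.1 - d.2) / dot (a q) (b q)) •
        normalProj x q (b₁ q)) p :=
      (differentiableAt_fun_div (f := fun _ => d.1 - d.2) (differentiableAt_const _) hab h0).fun_smul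
        (h.differentiableAt_normalProj hp (h.differentiableAt_b₁ hp))
    have h1 := hasFDerivAt_smul_of_eq_zero (f := fun q => dot n (b q))
      (hasFDerivAt_dot hn (h.hasFDerivAt_b p hp)) hP hnb
    have h2 := hasFDerivAt_smul_of_eq_zero (f := fun q => dot n (a q))
      (hasFDerivAt_dot hn (h.hasFDerivAt_a p hp)) hQ hna
    have heq : (normalDeriv x d fun q => normalProj x q n) =ᶠ[nhds p] fun q =>
        -(dot n (b q) • ((d.1 + d.2) / dot (a q) (b q)) • normalProj x q (a₁ q) +
        dot n (a q) • ((d.1 - d.2) / dot (a q) (b q)) • normalProj x q (b₁ q)) := by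
      filter_upwards [h.isOpen.mem_nhds hp] with q hq using h.normalDeriv_normalProj hq n d
    rw [normalDeriv, heq.fderiv_eq, (h1.fun_add h2).fun_neg.fderiv]
    simp [normalProj_neg, normalProj_add, normalProj_smul, h.normalProj_normalProj hp,
      smul_smul]
  rw [normalCurvatureTensor, key, key]
  simp only [dot_sub_left, dot_neg_left, dot_add_left, dot_smul_left, h.dot_normalProj hp _ hna' hnb',
    dot_comm (a₁ p), dot_comm (b₁ p)]
  ring

lemma dot_a_eq_zero (h : IsNullFrame x a b a₁ b₁ W) (hp : p ∈ W) {n : R42}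
    (hn : ∀ c, dot (fderiv ℝ x p c) n = 0) : dot n (a p) = 0 := by
  have := hn (1 / 2, 1 / 2)
  rw [h.fderiv_apply hp] at this
  rw [dot_comm]
  norm_num at this
  exact this

lemma dot_b_eq_zero (h : IsNullFrame x a b a₁ b₁ W) (hp : p ∈ W) {n : R42}
    (hn : ∀ c, dot (fderiv ℝ x p c) n = 0) : dot n (b p) = 0 := by
  have := hn (1 / 2, -1 / 2)
  rw [h.fderiv_apply hp] at this
  rw [dot_comm]
  norm_num at this
  exact this

lemma normalCurvature_eq (h : IsNullFrame x a b a₁ b₁ W) (hp : p ∈ W) {k : ℝ}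
    (hk : HasNormalCurvature x p k) :
    k = -det4 (a p) (b p) (a₁ p) (b₁ p) / dot (a p) (b p) ^ 3 := by
  obtain ⟨c, d, n₁, n₂, hf, rfl⟩ := hk
  have h0 := (h.dot_a_b p hp).ne
  have h1a := h.dot_a_eq_zero hp hf.normal₁
  have h1b := h.dot_b_eq_zero hp hf.normal₁
  have h2a := h.dot_a_eq_zero hp hf.normal₂
  have h2b := h.dot_b_eq_zero hp hf.normal₂
  have hpos : 0 < det4 (fderiv ℝ x p c) (fderiv ℝ x p d) n₁ n₂ := hf.rightOriented
  have hsq := det4_mul_det4 (fderiv ℝ x p c) (fderiv ℝ x p d) n₁ n₂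
    (fderiv ℝ x p c) (fderiv ℝ x p d) n₁ n₂
  simp only [hf.tangent₁₁, hf.tangent₁₂, hf.tangent₂₂, hf.normal₁₁, hf.normal₁₂, hf.normal₂₂, hf.normal₁,
    hf.normal₂, dot_comm (fderiv ℝ x p d) (fderiv ℝ x p c), dot_comm n₂ n₁,
    dot_comm n₁ (fderiv ℝ x p _), dot_comm n₂ (fderiv ℝ x p _)] at hsq
  rw [det4_eq (![_, _, _, _] : R42)] at hsq
  simp at hsq
  -- The Gram determinant of the frame is 1, and the orientation excludes the value -1.
  have hone : det4 (fderiv ℝ x p c) (fderiv ℝ x p d) n₁ n₂ = 1 := by nlinarith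
  -- Multiplication by this unit determinant turns det(a, b, a₁, b₁) into a block triangular matrix
  -- of scalar products: a tangent minor times the normal minor found in the curvature.
  have hmix := det4_mul_det4 (fderiv ℝ x p c) (fderiv ℝ x p d) n₁ n₂ (a p) (b p) (a₁ p) (b₁ p)
  rw [hone, h1a, h1b, h2a, h2b] at hmix
  simp only [h.fderiv_apply hp, dot_add_left, dot_smul_left, h.dot_a_a p hp, h.dot_b_b p hp,
    dot_comm (b p) (a p)] at hmix
  rw [det4_eq (![_, _, _, _] : R42)] at hmix
  simp at hmix
  rw [h.dot_normalCurvatureTensor hp c d h2a h2b h1a h1b, hmix]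
  field_simp
  ring

/-- Only the existence of an adapted frame is at stake. The normal part P of a₁ and n = a × b × P
are orthogonal normal vectors with n · n = -(a · b)² P · P, so they have opposite causal characters
and can be normalized. -/
lemma hasNormalCurvature (h : IsNullFrame x a b a₁ b₁ W) (hp : p ∈ W)
    (hf : dot (a₁ p) (a₁ p) ≠ 0) : HasNormalCurvature x p
      (-det4 (a p) (b p) (a₁ p) (b₁ p) / dot (a p) (b p) ^ 3) := by
  suffices ∃ c d n₁ n₂, IsAdaptedFrame x p c d n₁ n₂ by
    obtain ⟨c, d, n₁, n₂, hF⟩ := this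
    have hk : HasNormalCurvature x p _ := ⟨c, d, n₁, n₂, hF, rfl⟩
    rwa [← h.normalCurvature_eq hp hk]
  have h0 := (h.dot_a_b p hp).ne
  set η := dot (a p) (b p) with hη
  set P := normalProj x p (a₁ p) with hP
  have hP' : P = a₁ p - (dot (a₁ p) (b p) / η) • a p := by
    rw [hP, h.normalProj_eq hp, dot_comm (a₁ p) (a p), h.dot_a_a₁ hp]
    simp [hη]
  have hPa : dot P (a p) = 0 := by
    rw [hP', dot_sub_left, dot_smul_left, h.dot_a_a p hp, dot_comm, h.dot_a_a₁ hp]; ring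
  have hPb : dot P (b p) = 0 := by
    rw [hP', dot_sub_left, dot_smul_left, ← hη]; field_simp; ring
  have hPP : dot P P = dot (a₁ p) (a₁ p) := by
    nth_rewrite 2 [hP']
    rw [dot_sub_right, dot_smul_right, hPa, hP', dot_sub_left, dot_smul_left, h.dot_a_a₁ hp]; ring
  set n := cross (a p) (b p) P with hn
  have hna : dot n (a p) = 0 := dot_cross_first _ _ _
  have hnb : dot n (b p) = 0 := dot_cross_second _ _ _
  have hnP : dot n P = 0 := dot_cross_third _ _ _
  have hnn : dot n n = -(η ^ 2 * dot P P) := by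
    rw [hn, dot_cross_self, h.dot_a_a p hp, h.dot_b_b p hp, dot_comm (a p) P, dot_comm (b p) P, hPa,
      hPb]
    ring
  -- an orthonormal basis of the normal plane
  obtain ⟨n₁, n₂, h11, h22, h12, h1a, h1b, h2a, h2b⟩ : ∃ n₁ n₂ : R42, dot n₁ n₁ = -1 ∧
      dot n₂ n₂ = 1 ∧ dot n₁ n₂ = 0 ∧ dot n₁ (a p) = 0 ∧ dot n₁ (b p) = 0 ∧
      dot n₂ (a p) = 0 ∧ dot n₂ (b p) = 0 := by
    have hunit (w : R42) (hw : dot w w ≠ 0) :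
        dot ((√|dot w w|)⁻¹ • w) ((√|dot w w|)⁻¹ • w) = dot w w / |dot w w| := by
      have h1 : √|dot w w| ≠ 0 := by positivity
      have h2 := Real.sq_sqrt (abs_nonneg (dot w w))
      rw [dot_smul_left, dot_smul_right, div_eq_mul_inv]
      have h3 : |dot w w|⁻¹ = (√|dot w w|)⁻¹ * (√|dot w w|)⁻¹ := by rw [← mul_inv, ← sq, h2]
      rw [h3]
      ring
    have hnn0 : dot n n ≠ 0 := by
      rw [hnn, hPP]; simp [h0, hf]
    rw [← hPP] at hf
    have horth (r s : ℝ) : dot (r • n) (s • P) = 0 := by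
      rw [dot_smul_left, dot_smul_right, hnP]; ring
    rcases lt_or_gt_of_ne hf with hneg | hpos
    · refine ⟨(√|dot P P|)⁻¹ • P, (√|dot n n|)⁻¹ • n, ?_, ?_, ?_, ?_, ?_, ?_, ?_⟩
      · rw [hunit P hf, abs_of_neg hneg]; field_simp
      · have : 0 < dot n n := by rw [hnn]; nlinarith [sq_pos_of_ne_zero h0]
        rw [hunit n hnn0, abs_of_pos this]; field_simp
      · rw [dot_comm, horth]
      all_goals simp [dot_smul_left, hPa, hPb, hna, hnb]
    · refine ⟨(√|dot n n|)⁻¹ • n, (√|dot P P|)⁻¹ • P, ?_, ?_, ?_, ?_, ?_, ?_, ?_⟩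
      · have : dot n n < 0 := by rw [hnn]; nlinarith [sq_pos_of_ne_zero h0]
        rw [hunit n hnn0, abs_of_neg this]; field_simp
      · rw [hunit P hf, abs_of_pos hpos]; field_simp
      · rw [horth]
      all_goals simp [dot_smul_left, hPa, hPb, hna, hnb]
  have htan {m : R42} (hma : dot m (a p) = 0) (hmb : dot m (b p) = 0) (c : Plane) :
      dot (fderiv ℝ x p c) m = 0 := by
    rw [h.fderiv_apply hp, dot_add_left, dot_smul_left, dot_smul_left, dot_comm _ m, dot_comm _ m,
      hma, hmb]
    ring
  -- These are the coordinates of the tangent vectors a - b/(2η) and a + b/(2η), of squares -1 and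
  -- 1.
  set c : Plane := (1 / 2 - 1 / (4 * η), 1 / 2 + 1 / (4 * η)) with hc
  set d : Plane := (1 / 2 + 1 / (4 * η), 1 / 2 - 1 / (4 * η)) with hd
  have hcc : dot (fderiv ℝ x p c) (fderiv ℝ x p c) = -1 := by
    rw [h.dot_fderiv_fderiv hp, ← hη, hc]; field_simp; ring
  have hdd : dot (fderiv ℝ x p d) (fderiv ℝ x p d) = 1 := by
    rw [h.dot_fderiv_fderiv hp, ← hη, hd]; field_simp; ring
  have hcd : dot (fderiv ℝ x p c) (fderiv ℝ x p d) = 0 := by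
    rw [h.dot_fderiv_fderiv hp, ← hη, hd, hc]; field_simp; ring
  have hdet : det4 (fderiv ℝ x p c) (fderiv ℝ x p d) n₁ n₂ ≠ 0 := by
    intro h0
    have hsq := det4_mul_det4 (fderiv ℝ x p c) (fderiv ℝ x p d) n₁ n₂
      (fderiv ℝ x p c) (fderiv ℝ x p d) n₁ n₂
    simp only [h0, hcc, hcd, hdd, h11, h12, h22, htan h1a h1b, htan h2a h2b,
      dot_comm (fderiv ℝ x p d) (fderiv ℝ x p c), dot_comm n₂ n₁,
      dot_comm n₁ (fderiv ℝ x p _), dot_comm n₂ (fderiv ℝ x p _)] at hsq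
    rw [det4_eq] at hsq
    simp at hsq
  -- If the orientation is wrong, the sign of n₁ is changed.
  rcases lt_or_gt_of_ne hdet with hneg | hpos
  · refine ⟨c, d, -n₁, n₂, hcc, hdd, hcd, ?_, h22, ?_, htan ?_ ?_, htan h2a h2b, ?_⟩
    · rw [dot_neg_left, dot_neg_right, neg_neg, h11]
    · rw [dot_neg_left, h12, neg_zero]
    · rw [dot_neg_left, h1a, neg_zero]
    · rw [dot_neg_left, h1b, neg_zero]
    · change 0 < det4 _ _ _ _
      have : det4 (fderiv ℝ x p c) (fderiv ℝ x p d) (-n₁) n₂ =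
          -det4 (fderiv ℝ x p c) (fderiv ℝ x p d) n₁ n₂ := by
        simp only [det4_eq, Pi.neg_apply]; ring
      rw [this]; linarith
  · exact ⟨c, d, n₁, n₂, hcc, hdd, hcd, h11, h22, h12, htan h1a h1b, htan h2a h2b, hpos⟩

end IsNullFrame

/-! ### Rigidity -/

lemma exists_eq_sum_of_det4_ne_zero {v : Fin 4 → R42} (hv : (Matrix.of v).det ≠ 0) (w : R42) :
    ∃ c : Fin 4 → ℝ, w = ∑ i, c i • v i := by
  refine ⟨Matrix.vecMul w (Matrix.of v)⁻¹, ?_⟩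
  have h := Matrix.vecMul_eq_sum (Matrix.vecMul w (Matrix.of v)⁻¹) (Matrix.of v)
  rw [Matrix.vecMul_vecMul, Matrix.nonsing_inv_mul _ (isUnit_iff_ne_zero.2 hv),
    Matrix.vecMul_one] at h
  exact h

/-- A linear map which preserves the scalar products of a basis preserves all of them. -/
lemma exists_isometry_of_frame {v V : Fin 4 → R42} (hv : (Matrix.of v).det ≠ 0)
    (h : ∀ i j, dot (V i) (V j) = dot (v i) (v j)) :
    ∃ L : Matrix (Fin 4) (Fin 4) ℝ, (∀ a b : R42, dot (L.mulVec a) (L.mulVec b) = dot a b) ∧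
      ∀ i, L.mulVec (v i) = V i := by
  set L : Matrix (Fin 4) (Fin 4) ℝ := ((Matrix.of v)⁻¹ * Matrix.of V).transpose with hL
  have hLv (i : Fin 4) : L.mulVec (v i) = V i := by
    have h1 : Matrix.of v * ((Matrix.of v)⁻¹ * Matrix.of V) = Matrix.of V := by
      rw [← Matrix.mul_assoc, Matrix.mul_nonsing_inv _ (isUnit_iff_ne_zero.2 hv), Matrix.one_mul]
    rw [hL, Matrix.mulVec_transpose]
    ext j
    have := congrFun (congrFun h1 i) j
    simpa [Matrix.mul_apply, Matrix.vecMul, dotProduct] using this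
  refine ⟨L, fun w w' => ?_, hLv⟩
  obtain ⟨c, rfl⟩ := exists_eq_sum_of_det4_ne_zero hv w
  obtain ⟨d, rfl⟩ := exists_eq_sum_of_det4_ne_zero hv w'
  simp only [Fin.sum_univ_four, Matrix.mulVec_add, Matrix.mulVec_smul, hLv, dot_add_left,
    dot_add_right, dot_smul_left, dot_smul_right, h]

lemma dot_cross_self_of_null {a b c : R42} (haa : dot a a = 0) (hac : dot a c = 0) :
    dot (cross a b c) (cross a b c) = -(dot a b ^ 2 * dot c c) := by
  rw [dot_cross_self, haa, hac]; ring

/-- L is defined on the basis a, b, a₁, n = a × b × a₁, whose determinant is n · n. This number is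
the same for the image basis, whence det L = 1. The vectors L b₁ and B₁ have equal products with the
image basis; for the last basis vector this is the equality of the determinants. -/
lemma exists_isProperMotion {a b a₁ b₁ A B A₁ B₁ : R42} (h0 : dot a b ≠ 0) (haa : dot a a = 0)
    (hbb : dot b b = 0) (haa₁ : dot a a₁ = 0) (hbb₁ : dot b b₁ = 0) (hf : dot a₁ a₁ ≠ 0)
    (hAA : dot A A = 0) (hBB : dot B B = 0) (hAA₁ : dot A A₁ = 0) (hBB₁ : dot B B₁ = 0)
    (hAB : dot A B = dot a b) (hA₁B : dot A₁ B = dot a₁ b) (hAB₁ : dot A B₁ = dot a b₁)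
    (hA₁B₁ : dot A₁ B₁ = dot a₁ b₁) (hA₁A₁ : dot A₁ A₁ = dot a₁ a₁)
    (hdet : det4 A B A₁ B₁ = det4 a b a₁ b₁) :
    ∃ L : Matrix (Fin 4) (Fin 4) ℝ, IsProperMotion L ∧ L.mulVec a = A ∧ L.mulVec b = B ∧
      L.mulVec a₁ = A₁ ∧ L.mulVec b₁ = B₁ ∧
      L.mulVec (cross a b a₁) = cross A B A₁ := by
  have hnn := dot_cross_self_of_null (b := b) haa haa₁
  have hNN := dot_cross_self_of_null (b := B) hAA hAA₁
  have hn0 : dot (cross a b a₁) (cross a b a₁) ≠ 0 := by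
    rw [hnn]; simp [h0, hf]
  have hNn : dot (cross A B A₁) (cross A B A₁) = dot (cross a b a₁) (cross a b a₁) := by
    rw [hnn, hNN, hAB, hA₁A₁]
  have hd : det4 a b a₁ (cross a b a₁) ≠ 0 := by rwa [← dot_cross]
  obtain ⟨L, hL, hLv⟩ := exists_isometry_of_frame (v := ![a, b, a₁, cross a b a₁])
    (V := ![A, B, A₁, cross A B A₁]) hd (by
      intro i j
      fin_cases i <;> fin_cases j <;>
        simp [hAA, haa, hBB, hbb, hAA₁, haa₁, hAB, hA₁B, hA₁A₁, hNn, dot_cross_first,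
          dot_cross_second, dot_cross_third, dot_comm _ (cross A B A₁), dot_comm _ (cross a b a₁),
          dot_comm B A, dot_comm b a, dot_comm B A₁, dot_comm b a₁, dot_comm A₁ A, dot_comm a₁ a])
  have ea : L.mulVec a = A := hLv 0
  have eb : L.mulVec b = B := hLv 1
  have ea₁ : L.mulVec a₁ = A₁ := hLv 2
  have en : L.mulVec (cross a b a₁) = cross A B A₁ := hLv 3
  have hD := det4_mulVec L a b a₁ (cross a b a₁)
  rw [ea, eb, ea₁, en, ← dot_cross, ← dot_cross, hNn] at hD
  refine ⟨L, ⟨hL, ?_⟩, ea, eb, ea₁, ?_, en⟩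
  · exact (mul_eq_right₀ hn0).1 hD.symm
  · have hDD : det4 A B A₁ (cross A B A₁) ≠ 0 := by rwa [← dot_cross, hNn]
    refine sub_eq_zero.1 (eq_zero_of_dot_eq_zero hDD ?_ ?_ ?_ ?_)
    · rw [dot_sub_left, dot_comm B₁, hAB₁, ← ea, hL, dot_comm]; ring
    · rw [dot_sub_left, dot_comm B₁, hBB₁, ← eb, hL, dot_comm, hbb₁]; ring
    · rw [dot_sub_left, dot_comm B₁, hA₁B₁, ← ea₁, hL, dot_comm]; ring
    · rw [dot_sub_left, dot_comm B₁, dot_cross, hdet, ← en, hL, dot_comm, dot_cross]; ring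

/-- The expansion of a vector in the frame `(a, b, c, a × b × c)`. -/
lemma eq_frame_expansion {a b c : R42} (h0 : dot a b ≠ 0) (haa : dot a a = 0) (hbb : dot b b = 0)
    (hac : dot a c = 0) (hcc : dot c c ≠ 0) (w : R42) :
    w = ((dot w b - (dot w c - dot w a / dot a b * dot b c) / dot c c * dot b c) / dot a b) • a +
      (dot w a / dot a b) • b + ((dot w c - dot w a / dot a b * dot b c) / dot c c) • c +
      (dot w (cross a b c) / dot (cross a b c) (cross a b c)) • cross a b c := by
  have hn0 : dot (cross a b c) (cross a b c) ≠ 0 := by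
    rw [dot_cross_self_of_null haa hac]; simp [h0, hcc]
  have hd : det4 a b c (cross a b c) ≠ 0 := by rwa [← dot_cross]
  refine sub_eq_zero.1 (eq_zero_of_dot_eq_zero hd ?_ ?_ ?_ ?_)
  all_goals
    simp only [dot_sub_left, dot_add_left, dot_smul_left, haa, hbb, hac, dot_comm b a, dot_comm c a,
      dot_comm c b, dot_cross_first, dot_cross_second, dot_cross_third, dot_comm a (cross a b c),
      dot_comm b (cross a b c), dot_comm c (cross a b c)]
    field_simp
    ring

/-! ### Derivatives of vector products and of moving matrices. -/

section Calculus

variable {E : Type*} [NormedAddCommGroup E] [NormedSpace ℝ E] {p : E}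

lemma differentiableAt_cross {a b c : E → R42} (ha : DifferentiableAt ℝ a p)
    (hb : DifferentiableAt ℝ b p) (hc : DifferentiableAt ℝ c p) :
    DifferentiableAt ℝ (fun q => cross (a q) (b q) (c q)) p := by
  have ha' := differentiableAt_pi.1 ha
  have hb' := differentiableAt_pi.1 hb
  have hc' := differentiableAt_pi.1 hc
  refine differentiableAt_pi.2 fun i => ?_
  fin_cases i <;> simp [cross, det4_eq] <;> fun_prop

lemma fderiv_mulVec_apply {L : E → Matrix (Fin 4) (Fin 4) ℝ}
    {L' : Fin 4 → Fin 4 → E →L[ℝ] ℝ} (hL : ∀ i j, HasFDerivAt (fun q => L q i j) (L' i j) p)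
    {g : E → R42} {g' : E →L[ℝ] R42} (hg : HasFDerivAt g g' p) (e : E) :
    HasFDerivAt (fun q => (L q).mulVec (g q))
        (fderiv ℝ (fun q => (L q).mulVec (g q)) p) p ∧
      fderiv ℝ (fun q => (L q).mulVec (g q)) p e =
        (Matrix.of fun i j => L' i j e).mulVec (g p) + (L p).mulVec (g' e) := by
  have hg' := hasFDerivAt_pi'.1 hg
  have h : HasFDerivAt (fun q => (L q).mulVec (g q)) (ContinuousLinearMap.pi fun i =>
      ∑ j, (L p i j • (ContinuousLinearMap.proj j ∘L g') + g p j • L' i j)) p := by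
    refine hasFDerivAt_pi.2 fun i => ?_
    exact HasFDerivAt.fun_sum (u := Finset.univ) fun j _ => (hL i j).fun_mul (hg' j)
  refine ⟨h.differentiableAt.hasFDerivAt, ?_⟩
  rw [h.fderiv]
  ext i
  simp [Matrix.mulVec, dotProduct, Finset.sum_add_distrib, mul_comm, add_comm]

end Calculus

/-- D plays the role of a derivative of isometries L, so L⁻¹D is skew. The image of D is orthogonal
to L v for every v in the kernel of D, and D v₃ is orthogonal to L v₃ by skewness. A skew map with a
three-dimensional kernel is therefore zero. -/
lemma eq_zero_of_skew {L D : Matrix (Fin 4) (Fin 4) ℝ}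
    (hskew : ∀ w w' : R42, dot (L.mulVec w) (D.mulVec w') + dot (D.mulVec w) (L.mulVec w') = 0)
    {v₀ v₁ v₂ v₃ : R42} (hdet : det4 (L.mulVec v₀) (L.mulVec v₁) (L.mulVec v₂) (L.mulVec v₃) ≠ 0)
    (h₀ : D.mulVec v₀ = 0) (h₁ : D.mulVec v₁ = 0) (h₂ : D.mulVec v₂ = 0) : D = 0 := by
  have hk {v : R42} (hv : D.mulVec v = 0) (w : R42) : dot (D.mulVec w) (L.mulVec v) = 0 := by
    have := hskew w v
    rwa [hv, dot_zero_right, zero_add] at this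
  have h₃ : D.mulVec v₃ = 0 := by
    refine eq_zero_of_dot_eq_zero hdet (hk h₀ _) (hk h₁ _) (hk h₂ _) ?_
    have := hskew v₃ v₃
    rw [dot_comm] at this
    linarith
  have hz (w : R42) : D.mulVec w = 0 :=
    eq_zero_of_dot_eq_zero hdet (hk h₀ _) (hk h₁ _) (hk h₂ _) (hk h₃ _)
  exact Matrix.ext_of_mulVec_single fun i => by rw [hz, Matrix.zero_mulVec]

namespace IsNullFrame

variable {x a b a₁ b₁ X A B A₁ B₁ : Plane → R42} {W : Set Plane} {p : Plane}

lemma hasFDerivAt_dot_a_b (h : IsNullFrame x a b a₁ b₁ W) (hp : p ∈ W) :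
    HasFDerivAt (fun q => dot (a q) (b q))
      (dot (a p) (b₁ p) • tau + dot (a₁ p) (b p) • sig) p :=
  (hasFDerivAt_dot (h.hasFDerivAt_a p hp) (h.hasFDerivAt_b p hp)).congr_fderiv (by
    refine ContinuousLinearMap.ext fun c => ?_
    simp [-sig_apply, -tau_apply, mul_comm])

/-- The scalar products of the derivatives of `a` and `b` are determined by the metric. -/
lemma dot_derivatives_eq (h : IsNullFrame x a b a₁ b₁ W) (H : IsNullFrame X A B A₁ B₁ W)
    (hE : ∀ q ∈ W, dot (A q) (B q) = dot (a q) (b q)) (hp : p ∈ W) :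
    dot (A₁ p) (B p) = dot (a₁ p) (b p) ∧ dot (A p) (B₁ p) = dot (a p) (b₁ p) ∧
      dot (A₁ p) (B₁ p) = dot (a₁ p) (b₁ p) := by
  have key : ∀ q ∈ W, dot (A₁ q) (B q) = dot (a₁ q) (b q) ∧ dot (A q) (B₁ q) = dot (a q) (b₁ q) := by
    intro q hq
    have heq : (fun q => dot (a q) (b q)) =ᶠ[nhds q] fun q => dot (A q) (B q) := by
      filter_upwards [h.isOpen.mem_nhds hq] with r hr using (hE r hr).symm
    have e := (H.hasFDerivAt_dot_a_b hq).unique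
      ((h.hasFDerivAt_dot_a_b hq).congr_of_eventuallyEq heq.symm)
    have e1 := congrArg (fun f : Plane →L[ℝ] ℝ => f (1, 0)) e
    have e2 := congrArg (fun f : Plane →L[ℝ] ℝ => f (0, 1)) e
    simp at e1 e2
    constructor <;> linarith
  refine ⟨(key p hp).1, (key p hp).2, ?_⟩
  have heq : (fun q => dot (A₁ q) (B q)) =ᶠ[nhds p] fun q => dot (a₁ q) (b q) := by
    filter_upwards [h.isOpen.mem_nhds hp] with r hr using (key r hr).1
  -- In this direction σ = 0 and τ = 1: a₁ is constant and b has derivative b₁.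
  have e := congrArg (fun f : Plane →L[ℝ] ℝ => f (1 / 2, -1 / 2)) heq.fderiv_eq
  obtain ⟨a₂, ha₂⟩ := h.hasFDerivAt_a₁
  obtain ⟨A₂, hA₂⟩ := H.hasFDerivAt_a₁
  simp only [fderiv_dot_apply (ha₂ p hp) (h.hasFDerivAt_b p hp),
    fderiv_dot_apply (hA₂ p hp) (H.hasFDerivAt_b p hp)] at e
  norm_num [dot_zero_left] at e
  exact e

/-- Two minimal maps with the same metric, the same scalar square of `a₁` and the same
determinant `det (a, b, a₁, b₁)` differ by a proper motion. -/
lemma exists_motion (h : IsNullFrame x a b a₁ b₁ W) (H : IsNullFrame X A B A₁ B₁ W)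
    (hW : IsPreconnected W) (hne : W.Nonempty)
    (hE : ∀ q ∈ W, dot (A q) (B q) = dot (a q) (b q))
    (hf : ∀ q ∈ W, dot (A₁ q) (A₁ q) = dot (a₁ q) (a₁ q))
    (hf0 : ∀ q ∈ W, dot (a₁ q) (a₁ q) ≠ 0) (hg0 : ∀ q ∈ W, dot (b₁ q) (b₁ q) ≠ 0)
    (hdet : ∀ q ∈ W, det4 (A q) (B q) (A₁ q) (B₁ q) = det4 (a q) (b q) (a₁ q) (b₁ q)) :
    ∃ (L : Matrix (Fin 4) (Fin 4) ℝ) (d : R42), IsProperMotion L ∧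
      ∀ q ∈ W, X q = L.mulVec (x q) + d := by
  have hex (q : Plane) : ∃ L : Matrix (Fin 4) (Fin 4) ℝ, q ∈ W → IsProperMotion L ∧
      L.mulVec (a q) = A q ∧ L.mulVec (b q) = B q ∧ L.mulVec (a₁ q) = A₁ q ∧
      L.mulVec (b₁ q) = B₁ q ∧
      L.mulVec (cross (a q) (b q) (a₁ q)) = cross (A q) (B q) (A₁ q) := by
    by_cases hq : q ∈ W
    · obtain ⟨e1, e2, e3⟩ := h.dot_derivatives_eq H hE hq
      obtain ⟨L, hL⟩ := exists_isProperMotion (h.dot_a_b q hq).ne (h.dot_a_a q hq) (h.dot_b_b q hq)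
        (h.dot_a_a₁ hq) (h.dot_b_b₁ hq) (hf0 q hq) (H.dot_a_a q hq) (H.dot_b_b q hq)
        (H.dot_a_a₁ hq) (H.dot_b_b₁ hq) (hE q hq) e1 e2 e3 (hf q hq) (hdet q hq)
      exact ⟨L, fun _ => hL⟩
    · exact ⟨0, fun h => absurd h hq⟩
  choose L hL using hex
  -- `L` is differentiable
  have hdiff (w : R42) {p : Plane} (hp : p ∈ W) :
      DifferentiableAt ℝ (fun q => (L q).mulVec w) p := by
    have ha := h.differentiableAt_a hp
    have hb := h.differentiableAt_b hp
    have ha₁ := h.differentiableAt_a₁ hp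
    have hn := differentiableAt_cross ha hb ha₁
    have hA := H.differentiableAt_a hp
    have hB := H.differentiableAt_b hp
    have hA₁ := H.differentiableAt_a₁ hp
    have hN := differentiableAt_cross hA hB hA₁
    have hw : DifferentiableAt ℝ (fun _ : Plane => w) p := differentiableAt_const w
    have hab := differentiableAt_dot ha hb
    have h0 := (h.dot_a_b p hp).ne
    have hff := hf0 p hp
    have hnn : dot (cross (a p) (b p) (a₁ p)) (cross (a p) (b p) (a₁ p)) ≠ 0 := by
      rw [dot_cross_self_of_null (h.dot_a_a p hp) (h.dot_a_a₁ hp)]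
      simp [h0, hff]
    have c2 : DifferentiableAt ℝ (fun q => dot w (a q) / dot (a q) (b q)) p :=
      differentiableAt_fun_div (f := fun q => dot w (a q)) (differentiableAt_dot hw ha) hab h0
    have c3 : DifferentiableAt ℝ (fun q => (dot w (a₁ q) - dot w (a q) / dot (a q) (b q) *
        dot (b q) (a₁ q)) / dot (a₁ q) (a₁ q)) p :=
      differentiableAt_fun_div (f := fun q => dot w (a₁ q) - dot w (a q) / dot (a q) (b q) *
        dot (b q) (a₁ q)) ((differentiableAt_dot hw ha₁).fun_sub
          (c2.fun_mul (differentiableAt_dot hb ha₁))) (differentiableAt_dot ha₁ ha₁) hff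
    have c1 : DifferentiableAt ℝ (fun q => (dot w (b q) - (dot w (a₁ q) - dot w (a q) /
        dot (a q) (b q) * dot (b q) (a₁ q)) / dot (a₁ q) (a₁ q) * dot (b q) (a₁ q)) /
        dot (a q) (b q)) p :=
      differentiableAt_fun_div (f := fun q => dot w (b q) - (dot w (a₁ q) - dot w (a q) /
        dot (a q) (b q) * dot (b q) (a₁ q)) / dot (a₁ q) (a₁ q) * dot (b q) (a₁ q))
        ((differentiableAt_dot hw hb).fun_sub (c3.fun_mul (differentiableAt_dot hb ha₁))) hab h0
    have c4 : DifferentiableAt ℝ (fun q => dot w (cross (a q) (b q) (a₁ q)) /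
        dot (cross (a q) (b q) (a₁ q)) (cross (a q) (b q) (a₁ q))) p :=
      differentiableAt_fun_div (f := fun q => dot w (cross (a q) (b q) (a₁ q)))
        (differentiableAt_dot hw hn) (differentiableAt_dot hn hn) hnn
    refine (((((c1.fun_smul hA).fun_add (c2.fun_smul hB)).fun_add (c3.fun_smul hA₁))).fun_add
      (c4.fun_smul hN)).congr_of_eventuallyEq ?_
    filter_upwards [h.isOpen.mem_nhds hp] with q hq
    obtain ⟨-, ea, eb, ea₁, -, en⟩ := hL q hq
    conv_lhs => rw [eq_frame_expansion (h.dot_a_b q hq).ne (h.dot_a_a q hq) (h.dot_b_b q hq)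
        (h.dot_a_a₁ hq) (hf0 q hq) w]
    simp only [Matrix.mulVec_add, Matrix.mulVec_smul, ea, eb, ea₁, en]
  have hL' {p : Plane} (hp : p ∈ W) (i j : Fin 4) :
      HasFDerivAt (fun q => L q i j) (fderiv ℝ (fun q => L q i j) p) p := by
    have := differentiableAt_pi.1 (hdiff (Pi.single j 1) hp) i
    simp only [Matrix.mulVec_single_one] at this
    exact this.hasFDerivAt
  -- the derivative of `L` vanishes
  have hzero {p : Plane} (hp : p ∈ W) (e : Plane) :
      (Matrix.of fun i j => fderiv ℝ (fun q => L q i j) p e) = 0 := by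
    obtain ⟨hLp, ea, eb, ea₁, eb₁, en⟩ := hL p hp
    -- Differentiating L g = G gives L' g = ℓ(e) (G' - L g'), which vanishes in each of the two
    -- cases of `h0`.
    have hrule {g G g' G' : Plane → R42} {ℓ : Plane →L[ℝ] ℝ}
        (hg : HasFDerivAt g (ℓ.smulRight (g' p)) p) (hG : HasFDerivAt G (ℓ.smulRight (G' p)) p)
        (hgG : ∀ q ∈ W, (L q).mulVec (g q) = G q) (e : Plane)
        (h0 : ℓ e = 0 ∨ (L p).mulVec (g' p) = G' p) :
        (Matrix.of fun i j => fderiv ℝ (fun q => L q i j) p e).mulVec (g p) = 0 := by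
      have h1 := (fderiv_mulVec_apply (hL' hp) hg e).2
      have heq : (fun q => (L q).mulVec (g q)) =ᶠ[nhds p] G := by
        filter_upwards [h.isOpen.mem_nhds hp] with q hq using hgG q hq
      rw [heq.fderiv_eq, hG.fderiv] at h1
      simp only [ContinuousLinearMap.smulRight_apply, Matrix.mulVec_smul] at h1
      rcases h0 with h0 | h0
      · simpa [h0] using h1.symm
      · rw [h0] at h1
        simpa using h1
    have hskew (e : Plane) (w w' : R42) :
        dot ((L p).mulVec w) ((Matrix.of fun i j => fderiv ℝ (fun q => L q i j) p e).mulVec w') +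
        dot ((Matrix.of fun i j => fderiv ℝ (fun q => L q i j) p e).mulVec w)
          ((L p).mulVec w') = 0 := by
      have hw := fderiv_mulVec_apply (hL' hp) (hasFDerivAt_const w p) e
      have hw' := fderiv_mulVec_apply (hL' hp) (hasFDerivAt_const w' p) e
      have h1 := fderiv_dot_apply hw.1 hw'.1 e
      have heq : (fun q => dot ((L q).mulVec w) ((L q).mulVec w')) =ᶠ[nhds p]
          fun _ => dot w w' := by
        filter_upwards [h.isOpen.mem_nhds hp] with q hq using (hL q hq).1.1 w w'
      rw [heq.fderiv_eq, hw.2, hw'.2] at h1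
      simpa using h1.symm
    have hDa (e : Plane) := hrule (h.hasFDerivAt_a p hp) (H.hasFDerivAt_a p hp)
      (fun q hq => (hL q hq).2.1) e (Or.inr ea₁)
    have hDb (e : Plane) := hrule (h.hasFDerivAt_b p hp) (H.hasFDerivAt_b p hp)
      (fun q hq => (hL q hq).2.2.1) e (Or.inr eb₁)
    obtain ⟨a₂, ha₂⟩ := h.hasFDerivAt_a₁
    obtain ⟨A₂, hA₂⟩ := H.hasFDerivAt_a₁
    obtain ⟨b₂, hb₂⟩ := h.hasFDerivAt_b₁
    obtain ⟨B₂, hB₂⟩ := H.hasFDerivAt_b₁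
    have hframe {c : R42} (hac : dot (a p) c = 0 ∨ dot (b p) c = 0) (hcc : dot c c ≠ 0) :
        det4 ((L p).mulVec (a p)) ((L p).mulVec (b p)) ((L p).mulVec c)
          ((L p).mulVec (cross (a p) (b p) c)) ≠ 0 := by
      rw [det4_mulVec, hLp.2, one_mul, ← dot_cross, dot_cross_self, h.dot_a_a p hp, h.dot_b_b p hp]
      have := (h.dot_a_b p hp).ne
      rcases hac with hac | hac <;> simp [hac, this, hcc]
    -- L' kills a and b in every direction. Along τ the vector a₁ is constant, so L' kills it too;
    -- along σ the same holds for b₁.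
    have hs : (Matrix.of fun i j => fderiv ℝ (fun q => L q i j) p (1 / 2, -1 / 2)) = 0 :=
      eq_zero_of_skew (hskew _) (hframe (Or.inl (h.dot_a_a₁ hp)) (hf0 p hp)) (hDa _) (hDb _)
        (hrule (ha₂ p hp) (hA₂ p hp) (fun q hq => (hL q hq).2.2.2.1) _ (Or.inl (by norm_num)))
    have ht : (Matrix.of fun i j => fderiv ℝ (fun q => L q i j) p (1 / 2, 1 / 2)) = 0 :=
      eq_zero_of_skew (hskew _) (hframe (Or.inr (h.dot_b_b₁ hp)) (hg0 p hp)) (hDa _) (hDb _)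
        (hrule (hb₂ p hp) (hB₂ p hp) (fun q hq => (hL q hq).2.2.2.2.1) _ (Or.inl (by norm_num)))
    ext i j
    have hs' := congrFun (congrFun hs i) j
    have ht' := congrFun (congrFun ht i) j
    simp only [Matrix.of_apply, Matrix.zero_apply] at hs' ht' ⊢
    have he : e = (e.1 + e.2) • ((1 / 2, 1 / 2) : Plane) + (e.1 - e.2) • ((1 / 2, -1 / 2) : Plane) := by
      ext <;> simp <;> ring
    rw [he, map_add, map_smul, map_smul, hs', ht']
    simp
  obtain ⟨p₀, hp₀⟩ := hne
  have hconst {q : Plane} (hq : q ∈ W) : L q = L p₀ := by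
    ext i j
    refine h.isOpen.is_const_of_fderiv_eq_zero hW (f := fun q => L q i j)
      (fun r hr => (hL' hr i j).differentiableAt.differentiableWithinAt) (fun r hr => ?_) hq hp₀
    refine ContinuousLinearMap.ext fun e => ?_
    exact congrFun (congrFun (hzero hr e) i) j
  refine ⟨L p₀, X p₀ - (L p₀).mulVec (x p₀), (hL p₀ hp₀).1, fun q hq => ?_⟩
  have hder {r : Plane} (hr : r ∈ W) : HasFDerivAt (fun q => X q - (L p₀).mulVec (x q))
      (0 : Plane →L[ℝ] R42) r := by
    have h1 := ((Matrix.mulVecLin (L p₀)).toContinuousLinearMap.hasFDerivAt).comp r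
      (h.hasFDerivAt r hr)
    refine ((H.hasFDerivAt r hr).sub h1).congr_fderiv (ContinuousLinearMap.ext fun e => ?_)
    obtain ⟨-, ea, eb, -⟩ := hL r hr
    rw [hconst hr] at ea eb
    simp [ea, eb]
  have := h.isOpen.is_const_of_fderiv_eq_zero hW
    (fun r hr => (hder hr).differentiableAt.differentiableWithinAt)
    (fun r hr => (hder hr).fderiv) hq hp₀
  rw [← this]
  abel

end IsNullFrame

/-! ### General type, associated families and pull-backs -/

namespace IsNullFrame

variable {x a b a₁ b₁ X A B A₁ B₁ : Plane → R42} {W V : Set Plane} {p : Plane}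

/-- The tangent part of a₁ is a multiple of a, which is null and orthogonal to a₁. -/
lemma dot_normalProj_a₁ (h : IsNullFrame x a b a₁ b₁ W) (hp : p ∈ W) :
    dot (normalProj x p (a₁ p)) (normalProj x p (a₁ p)) = dot (a₁ p) (a₁ p) := by
  rw [h.normalProj_eq hp, dot_comm (a₁ p) (a p), h.dot_a_a₁ hp]
  simp [dot_sub_left, dot_sub_right, dot_smul_left, dot_smul_right, h.dot_a_a p hp,
    dot_comm (a₁ p) (a p), h.dot_a_a₁ hp]

lemma dot_normalProj_b₁ (h : IsNullFrame x a b a₁ b₁ W) (hp : p ∈ W) :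
    dot (normalProj x p (b₁ p)) (normalProj x p (b₁ p)) = dot (b₁ p) (b₁ p) := by
  rw [h.normalProj_eq hp, dot_comm (b₁ p) (b p), h.dot_b_b₁ hp]
  simp [dot_sub_left, dot_sub_right, dot_smul_left, dot_smul_right, h.dot_b_b p hp,
    dot_comm (b₁ p) (b p), h.dot_b_b₁ hp]

/-- With P, Q the normal parts of a₁, b₁ one has Φ'^⊥ = (P + Q) + j(P - Q), of scalar square 2(P² +
Q²) + 2j(P² - Q²). -/
lemma norm_dot_PhiPrimePerp (h : IsNullFrame x a b a₁ b₁ W) (hp : p ∈ W) :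
    QuadraticAlgebra.norm (dot (PhiPrimePerp x p) (PhiPrimePerp x p)) =
      16 * dot (a₁ p) (a₁ p) * dot (b₁ p) (b₁ p) := by
  have hre : normalProj x p (rePart (derivT (Phi x) p)) =
      normalProj x p (a₁ p) + normalProj x p (b₁ p) := by
    have : rePart (derivT (Phi x) p) = (1 / 2 : ℝ) •
        (fderiv ℝ (fun q => fderiv ℝ x q (1, 0)) p (1, 0) +
          fderiv ℝ (fun q => fderiv ℝ x q (0, 1)) p (0, 1)) := rfl
    rw [this, (h.hasFDerivAt_fderiv_apply hp _).fderiv, (h.hasFDerivAt_fderiv_apply hp _).fderiv,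
      ← normalProj_add]
    congr 1
    simp
    module
  have him : normalProj x p (imPart (derivT (Phi x) p)) =
      normalProj x p (a₁ p) - normalProj x p (b₁ p) := by
    have : imPart (derivT (Phi x) p) = (1 / 2 : ℝ) •
        (fderiv ℝ (fun q => fderiv ℝ x q (0, 1)) p (1, 0) +
          fderiv ℝ (fun q => fderiv ℝ x q (1, 0)) p (0, 1)) := rfl
    rw [this, (h.hasFDerivAt_fderiv_apply hp _).fderiv, (h.hasFDerivAt_fderiv_apply hp _).fderiv,
      sub_eq_add_neg (normalProj x p (a₁ p)), ← normalProj_neg, ← normalProj_add]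
    congr 1
    simp
    module
  rw [← h.dot_normalProj_a₁ hp, ← h.dot_normalProj_b₁ hp, PhiPrimePerp, hre, him]
  simp only [QuadraticAlgebra.norm_def, dot, toDouble, QuadraticAlgebra.re_add,
    QuadraticAlgebra.im_add, QuadraticAlgebra.re_sub, QuadraticAlgebra.im_sub,
    QuadraticAlgebra.re_neg, QuadraticAlgebra.im_neg, QuadraticAlgebra.re_mul,
    QuadraticAlgebra.im_mul, Pi.add_apply, Pi.sub_apply]
  ring

lemma dot_ne_zero_of_not_isDegenerate (h : IsNullFrame x a b a₁ b₁ W) (hp : p ∈ W)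
    (hd : ¬ IsDegenerate x p) : dot (a₁ p) (a₁ p) ≠ 0 ∧ dot (b₁ p) (b₁ p) ≠ 0 := by
  have h1 : QuadraticAlgebra.norm (dot (PhiPrimePerp x p) (PhiPrimePerp x p)) ≠ 0 := hd
  rw [h.norm_dot_PhiPrimePerp hp] at h1
  constructor <;> intro h0 <;> simp [h0] at h1

/-- Minimal maps on the same domain with the same metric and the same determinant
`det (a, b, a₁, b₁)` are strongly isometric. -/
lemma isStrongIsometry_id {M N : Patch} (h : IsNullFrame M.map a b a₁ b₁ M.domain)
    (H : IsNullFrame N.map A B A₁ B₁ M.domain) (hN : N.domain = M.domain)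
    (hE : ∀ q ∈ M.domain, dot (A q) (B q) = dot (a q) (b q))
    (hdet : ∀ q ∈ M.domain, det4 (A q) (B q) (A₁ q) (B₁ q) = det4 (a q) (b q) (a₁ q) (b₁ q))
    (hf : ∀ q ∈ M.domain, dot (a₁ q) (a₁ q) ≠ 0) (hF : ∀ q ∈ M.domain, dot (A₁ q) (A₁ q) ≠ 0) :
    IsStrongIsometry M N id := by
  refine ⟨⟨⟨contDiffOn_id, ?_, id, contDiffOn_id, ?_, ?_⟩, fun p hp c d => ?_⟩, fun p hp => ?_⟩
  · rw [hN]; exact Set.mapsTo_id _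
  · rw [hN]; exact Set.mapsTo_id _
  · exact ⟨fun _ _ => rfl, fun _ _ => rfl⟩
  · rw [fderiv_id]
    simp only [id, ContinuousLinearMap.id_apply]
    rw [H.dot_fderiv_fderiv hp, h.dot_fderiv_fderiv hp, hE p hp]
  · refine ⟨_, h.hasNormalCurvature hp (hf p hp), ?_⟩
    rw [← hE p hp, ← hdet p hp]
    exact H.hasNormalCurvature hp (hF p hp)

/-- In null coordinates, harmonic conjugation is (a, b) ↦ (a, -b). -/
lemma hasFDerivAt_of_isHarmonicConjugate {M : Patch} (h : IsNullFrame M.map a b a₁ b₁ M.domain)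
    {y : Plane → R42} (hy : IsHarmonicConjugate M y) (hp : p ∈ M.domain) :
    HasFDerivAt y (sig.smulRight (a p) + tau.smulRight (-b p)) p := by
  have hd := (differentiableAt_of_contDiffOn h.isOpen hy.1 hp).hasFDerivAt
  obtain ⟨hu, hv⟩ := hy.2 p hp
  rw [h.dv_eq hp] at hu
  rw [h.du_eq hp] at hv
  refine hd.congr_fderiv (ContinuousLinearMap.ext fun c => ?_)
  have hc : c = c.1 • ((1, 0) : Plane) + c.2 • ((0, 1) : Plane) := by simp
  have h1 : fderiv ℝ y p c = c.1 • du y p + c.2 • dv y p := by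
    conv_lhs => rw [hc, map_add, map_smul, map_smul]
    rfl
  rw [h1, hu, hv]
  simp only [_root_.add_apply, ContinuousLinearMap.smulRight_apply, sig_apply, tau_apply]
  module

/-- The null frame of the associated surface `M_θ`. -/
lemma associated {M : Patch} (h : IsNullFrame M.map a b a₁ b₁ M.domain)
    {y : Plane → R42} (hy : IsHarmonicConjugate M y) (θ : ℝ) :
    IsNullFrame (M.associated y θ).map (fun p => Real.exp θ • a p) (fun p => Real.exp (-θ) • b p)
      (fun p => Real.exp θ • a₁ p) (fun p => Real.exp (-θ) • b₁ p) M.domain where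
  isOpen := h.isOpen
  contDiffOn := (h.contDiffOn.const_smul _).add (hy.1.const_smul _)
  hasFDerivAt p hp := by
    refine (((h.hasFDerivAt p hp).const_smul (Real.cosh θ)).add
      ((h.hasFDerivAt_of_isHarmonicConjugate hy hp).const_smul (Real.sinh θ))).congr_fderiv
      (ContinuousLinearMap.ext fun c => ?_)
    simp only [_root_.add_apply, _root_.smul_apply, ContinuousLinearMap.smulRight_apply,
      ← Real.cosh_add_sinh, Real.cosh_neg, Real.sinh_neg]
    module
  hasFDerivAt_a p hp := ((h.hasFDerivAt_a p hp).fun_const_smul _).congr_fderiv (by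
    exact ContinuousLinearMap.ext fun c => smul_comm (Real.exp θ) (sig c) (a₁ p))
  hasFDerivAt_b p hp := ((h.hasFDerivAt_b p hp).fun_const_smul _).congr_fderiv (by
    exact ContinuousLinearMap.ext fun c => smul_comm (Real.exp (-θ)) (tau c) (b₁ p))
  dot_a_a p hp := by simp [dot_smul_left, dot_smul_right, h.dot_a_a p hp]
  dot_b_b p hp := by simp [dot_smul_left, dot_smul_right, h.dot_b_b p hp]
  dot_a_b p hp := by
    rw [dot_smul_left, dot_smul_right, ← mul_assoc, ← Real.exp_add]
    simpa using h.dot_a_b p hp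

lemma contDiffOn_mulVec {f : Plane → R42} (hf : ContDiffOn ℝ ∞ f W)
    (L : Matrix (Fin 4) (Fin 4) ℝ) : ContDiffOn ℝ ∞ (fun q => L.mulVec (f q)) W :=
  (Matrix.mulVecLin L).toContinuousLinearMap.contDiff.comp_contDiffOn hf

lemma hasFDerivAt_mulVec {f : Plane → R42} {f' : Plane →L[ℝ] R42} (hf : HasFDerivAt f f' p)
    (L : Matrix (Fin 4) (Fin 4) ℝ) : HasFDerivAt (fun q => L.mulVec (f q))
      ((Matrix.mulVecLin L).toContinuousLinearMap ∘L f') p :=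
  (Matrix.mulVecLin L).toContinuousLinearMap.hasFDerivAt.comp p hf

/-- The null frame of the surface `M̄^a`. -/
lemma conj_anti {M : Patch} (h : IsNullFrame M.map a b a₁ b₁ M.domain)
    {y : Plane → R42} (hy : IsHarmonicConjugate M y) {L : Matrix (Fin 4) (Fin 4) ℝ}
    (hL : IsProperAntiIsometry L) (c : R42) :
    IsNullFrame ((M.conj y).anti L c).map (fun p => L.mulVec (a p)) (fun p => -L.mulVec (b p))
      (fun p => L.mulVec (a₁ p)) (fun p => -L.mulVec (b₁ p)) M.domain where
  isOpen := h.isOpen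
  contDiffOn := (contDiffOn_mulVec hy.1 L).add contDiffOn_const
  hasFDerivAt p hp := by
    refine ((hasFDerivAt_mulVec (h.hasFDerivAt_of_isHarmonicConjugate hy hp) L).add_const
      c).congr_fderiv (ContinuousLinearMap.ext fun e => ?_)
    simp [Matrix.mulVec_neg, Matrix.mulVec_smul]
  hasFDerivAt_a p hp := (hasFDerivAt_mulVec (h.hasFDerivAt_a p hp) L).congr_fderiv (by
    refine ContinuousLinearMap.ext fun e => ?_
    simp)
  hasFDerivAt_b p hp := (hasFDerivAt_mulVec (h.hasFDerivAt_b p hp) L).fun_neg.congr_fderiv (by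
    refine ContinuousLinearMap.ext fun e => ?_
    simp)
  dot_a_a p hp := by rw [hL.1, h.dot_a_a p hp, neg_zero]
  dot_b_b p hp := by simp [dot_neg_left, dot_neg_right, hL.1, h.dot_b_b p hp]
  dot_a_b p hp := by simpa [dot_neg_right, hL.1] using h.dot_a_b p hp

lemma det4_conj_anti {L : Matrix (Fin 4) (Fin 4) ℝ} (hL : L.det = 1) (a b a₁ b₁ : R42) :
    det4 (L.mulVec a) (-L.mulVec b) (L.mulVec a₁) (-L.mulVec b₁) = det4 a b a₁ b₁ := by
  rw [← Matrix.mulVec_neg, ← Matrix.mulVec_neg, det4_mulVec, hL]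
  simp only [det4_eq, Pi.neg_apply]
  ring

lemma det4_exp_smul (θ : ℝ) (a b a₁ b₁ : R42) :
    det4 (Real.exp θ • a) (Real.exp (-θ) • b) (Real.exp θ • a₁) (Real.exp (-θ) • b₁) =
      det4 a b a₁ b₁ := by
  have h : Real.exp θ * Real.exp (-θ) = 1 := by rw [← Real.exp_add]; simp
  have : det4 (Real.exp θ • a) (Real.exp (-θ) • b) (Real.exp θ • a₁) (Real.exp (-θ) • b₁) =
      (Real.exp θ * Real.exp (-θ)) ^ 2 * det4 a b a₁ b₁ := by
    simp only [det4_eq, Pi.smul_apply, smul_eq_mul]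
    ring
  rw [this, h]; ring

lemma dot_exp_smul (θ : ℝ) (a b : R42) : dot (Real.exp θ • a) (Real.exp (-θ) • b) = dot a b := by
  rw [dot_smul_left, dot_smul_right, ← mul_assoc, ← Real.exp_add]
  simp

lemma associated_isStrongIsometry {M : Patch} (h : IsNullFrame M.map a b a₁ b₁ M.domain)
    (hf : ∀ q ∈ M.domain, dot (a₁ q) (a₁ q) ≠ 0) {y : Plane → R42}
    (hy : IsHarmonicConjugate M y) (θ : ℝ) :
    IsMinimal (M.associated y θ) ∧ IsStrongIsometry M (M.associated y θ) id := by
  have H := h.associated hy θ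
  refine ⟨isMinimal_of_isNullFrame H, h.isStrongIsometry_id H rfl (fun q _ => dot_exp_smul _ _ _)
    (fun q _ => det4_exp_smul _ _ _ _ _) hf fun q hq => ?_⟩
  simp [dot_smul_left, dot_smul_right, hf q hq]

/-- The two coordinate swaps cancel definitionally, so everything lives over `M.domain`. Relative to
M the scalar square of a₁ is multiplied by -e^{2θ}. -/
lemma conjAntiAssociated {M : Patch} (h : IsNullFrame M.map a b a₁ b₁ M.domain)
    {y : Plane → R42} {L : Matrix (Fin 4) (Fin 4) ℝ} {c : R42} {z : Plane → R42}
    (hd : IsConjAntiData M y L c z) (θ : ℝ) :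
    IsNullFrame (M.conjAntiAssociated y L c z θ).map (fun p => Real.exp θ • L.mulVec (a p))
      (fun p => Real.exp (-θ) • -L.mulVec (b p)) (fun p => Real.exp θ • L.mulVec (a₁ p))
      (fun p => Real.exp (-θ) • -L.mulVec (b₁ p)) M.domain :=
  associated (M := (M.conj y).anti L c) (h.conj_anti hd.conj_y hd.anti_A c) hd.conj_z θ

lemma conjAntiAssociated_isStrongIsometry {M : Patch} (h : IsNullFrame M.map a b a₁ b₁ M.domain)
    (hf : ∀ q ∈ M.domain, dot (a₁ q) (a₁ q) ≠ 0) {y : Plane → R42}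
    {L : Matrix (Fin 4) (Fin 4) ℝ} {c : R42} {z : Plane → R42}
    (hd : IsConjAntiData M y L c z) (θ : ℝ) :
    IsMinimal (M.conjAntiAssociated y L c z θ) ∧
      IsStrongIsometry M (M.conjAntiAssociated y L c z θ) id := by
  have H := h.conjAntiAssociated hd θ
  refine ⟨isMinimal_of_isNullFrame (M := M.conjAntiAssociated y L c z θ) H,
    h.isStrongIsometry_id H rfl (fun q _ => ?_) (fun q _ => ?_) hf fun q hq => ?_⟩
  · rw [dot_exp_smul, dot_neg_right, hd.anti_A.1, neg_neg]
  · rw [det4_exp_smul, det4_conj_anti hd.anti_A.2]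
  · simp [dot_smul_left, dot_smul_right, hd.anti_A.1, hf q hq]

/-- Existence of a harmonic conjugate over a convex domain. -/
lemma exists_isHarmonicConjugate {M : Patch} (h : IsNullFrame M.map a b a₁ b₁ M.domain)
    (hc : Convex ℝ M.domain) : ∃ y, IsHarmonicConjugate M y := by
  set η : Plane → Plane →L[ℝ] R42 := fun p => sig.smulRight (a p) + tau.smulRight (-b p) with hη
  have hηs : ContDiffOn ℝ ∞ η M.domain :=
    ((ContinuousLinearMap.smulRightL ℝ Plane R42 sig).contDiff.comp_contDiffOn h.contDiffOn_a).add
      ((ContinuousLinearMap.smulRightL ℝ Plane R42 tau).contDiff.comp_contDiffOn h.contDiffOn_b.neg)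
  have hd {p : Plane} (hp : p ∈ M.domain) := differentiableAt_of_contDiffOn h.isOpen hηs hp
  have hdη {p : Plane} (hp : p ∈ M.domain) (c e : Plane) :
      fderiv ℝ η p c e = (sig c * sig e) • a₁ p - (tau c * tau e) • b₁ p := by
    have h1 : fderiv ℝ (fun q => η q e) p c = fderiv ℝ η p c e := by
      rw [fderiv_clm_apply (hd hp) (differentiableAt_const _)]; simp
    have h2 : HasFDerivAt (fun q => η q e) _ p :=
      ((h.hasFDerivAt_a p hp).fun_const_smul (sig e)).fun_add
        ((h.hasFDerivAt_b p hp).fun_neg.fun_const_smul (tau e))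
    rw [← h1, h2.fderiv]
    simp only [_root_.add_apply, _root_.smul_apply, _root_.neg_apply,
      ContinuousLinearMap.smulRight_apply]
    module
  -- Poincaré lemma: the form a dσ - b dτ is closed because a depends only on σ and b only on τ.
  obtain ⟨y, hy⟩ := hc.exists_forall_hasFDerivAt_of_fderiv_symmetric h.isOpen
    (fun p hp => (hd hp).differentiableWithinAt) (fun p hp c e => by
      rw [hdη hp, hdη hp, mul_comm (sig c), mul_comm (tau c)])
  refine ⟨y, ?_, fun p hp => ?_⟩
  · refine (contDiffOn_infty_iff_fderiv_of_isOpen h.isOpen).2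
      ⟨fun p hp => (hy p hp).differentiableAt.differentiableWithinAt, ?_⟩
    exact hηs.congr fun p hp => (hy p hp).fderiv
  · rw [h.dv_eq hp, h.du_eq hp, du, dv, (hy p hp).fderiv]
    simp [hη, sub_eq_add_neg]

/-- The anti-isometry which exchanges the first two and the last two coordinates. -/
def swapMatrix : Matrix (Fin 4) (Fin 4) ℝ :=
  Matrix.of ![![0, 1, 0, 0], ![1, 0, 0, 0], ![0, 0, 0, 1], ![0, 0, 1, 0]]

lemma isProperAntiIsometry_swapMatrix : IsProperAntiIsometry swapMatrix := by
  constructor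
  · intro a b
    simp [dot, swapMatrix, Matrix.mulVec, dotProduct, Fin.sum_univ_four]
    ring
  · change det4 _ _ _ _ = 1
    rw [det4_eq]
    simp

/-- Conjugating twice returns x, so S x is conjugate to S y for the swap matrix S, and only y
requires an integration. -/
lemma exists_isConjAntiData {M : Patch} (h : IsNullFrame M.map a b a₁ b₁ M.domain)
    (hc : Convex ℝ M.domain) : ∃ y L c z, IsConjAntiData M y L c z := by
  obtain ⟨y, hy⟩ := h.exists_isHarmonicConjugate hc
  have H := h.conj_anti hy isProperAntiIsometry_swapMatrix 0
  refine ⟨y, swapMatrix, 0, fun q => swapMatrix.mulVec (M.map q), hy,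
    isProperAntiIsometry_swapMatrix, contDiffOn_mulVec h.contDiffOn _, fun p hp => ?_⟩
  have hp : p ∈ M.domain := hp
  rw [H.du_eq hp, H.dv_eq hp, du, dv, (hasFDerivAt_mulVec (h.hasFDerivAt p hp) _).fderiv]
  simp [sub_eq_add_neg, Matrix.mulVec_neg]

/-- A minimal map composed with a map which preserves both families of null lines. -/
lemma comp_of_null (H : IsNullFrame X A B A₁ B₁ V) {f : Plane → Plane} {m k : Plane → ℝ}
    (hW : IsOpen W) (hf : ContDiffOn ℝ ∞ f W) (hfV : Set.MapsTo f W V)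
    (hm : ∀ q ∈ W, sig ∘L fderiv ℝ f q = m q • sig) (hk : ∀ q ∈ W, tau ∘L fderiv ℝ f q = k q • tau)
    (hneg : ∀ q ∈ W, m q * k q * dot (A (f q)) (B (f q)) < 0) :
    ∃ m' k' : Plane → ℝ, IsNullFrame (X ∘ f) (fun q => m q • A (f q)) (fun q => k q • B (f q))
      (fun q => m q ^ 2 • A₁ (f q) + m' q • A (f q))
      (fun q => k q ^ 2 • B₁ (f q) + k' q • B (f q)) W := by
  have hfd {q : Plane} (hq : q ∈ W) := (differentiableAt_of_contDiffOn hW hf hq).hasFDerivAt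
  -- The σ-component of f depends only on σ, hence so does its derivative m; likewise k depends only
  -- on τ.
  have hsig := (hasFDerivAt_of_hasFDerivAt_smulRight (ℓ := sig) (e := ((1 : ℝ), (0 : ℝ))) (by simp)
    hW (sig.contDiff.comp_contDiffOn hf) (g₁ := m) fun q hq =>
      (sig.hasFDerivAt.comp q (hfd hq)).congr_fderiv (by
        rw [hm q hq]; refine ContinuousLinearMap.ext fun c => ?_; simp [mul_comm])).2
  have htau := (hasFDerivAt_of_hasFDerivAt_smulRight (ℓ := tau) (e := ((1 : ℝ), (0 : ℝ))) (by simp)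
    hW (tau.contDiff.comp_contDiffOn hf) (g₁ := k) fun q hq =>
      (tau.hasFDerivAt.comp q (hfd hq)).congr_fderiv (by
        rw [hk q hq]; refine ContinuousLinearMap.ext fun c => ?_; simp [mul_comm])).2
  have hm' {q : Plane} (hq : q ∈ W) (c : Plane) : sig (fderiv ℝ f q c) = m q * sig c :=
    congrArg (fun g : Plane →L[ℝ] ℝ => g c) (hm q hq)
  have hk' {q : Plane} (hq : q ∈ W) (c : Plane) : tau (fderiv ℝ f q c) = k q * tau c :=
    congrArg (fun g : Plane →L[ℝ] ℝ => g c) (hk q hq)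
  refine ⟨fun q => fderiv ℝ m q (1, 0), fun q => fderiv ℝ k q (1, 0), hW,
    H.contDiffOn.comp hf hfV, fun q hq => ?_, fun q hq => ?_, fun q hq => ?_, fun q hq => ?_,
    fun q hq => ?_, fun q hq => ?_⟩
  · refine ((H.hasFDerivAt _ (hfV hq)).comp q (hfd hq)).congr_fderiv
      (ContinuousLinearMap.ext fun c => ?_)
    simp only [ContinuousLinearMap.comp_apply, _root_.add_apply,
      ContinuousLinearMap.smulRight_apply, hm' hq, hk' hq]
    module
  · refine ((hsig q hq).fun_smul ((H.hasFDerivAt_a _ (hfV hq)).comp q (hfd hq))).congr_fderiv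
      (ContinuousLinearMap.ext fun c => ?_)
    simp only [ContinuousLinearMap.comp_apply, _root_.add_apply, _root_.smul_apply,
      ContinuousLinearMap.smulRight_apply, hm' hq, Function.comp_apply, smul_eq_mul]
    module
  · refine ((htau q hq).fun_smul ((H.hasFDerivAt_b _ (hfV hq)).comp q (hfd hq))).congr_fderiv
      (ContinuousLinearMap.ext fun c => ?_)
    simp only [ContinuousLinearMap.comp_apply, _root_.add_apply, _root_.smul_apply,
      ContinuousLinearMap.smulRight_apply, hk' hq, Function.comp_apply, smul_eq_mul]
    module
  · simp [dot_smul_left, dot_smul_right, H.dot_a_a _ (hfV hq)]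
  · simp [dot_smul_left, dot_smul_right, H.dot_b_b _ (hfV hq)]
  · rw [dot_smul_left, dot_smul_right, ← mul_assoc]
    exact hneg q hq

/-- The terms with m' and k' are multiples of the first two vectors. The factor (mk)³ is also that
of (a · b)³, so the curvature quotient does not change. -/
lemma det4_comp (m k m' k' : ℝ) (a b a₁ b₁ : R42) :
    det4 (m • a) (k • b) (m ^ 2 • a₁ + m' • a) (k ^ 2 • b₁ + k' • b) =
      (m * k) ^ 3 * det4 a b a₁ b₁ := by
  simp only [det4_eq, Pi.smul_apply, Pi.add_apply, smul_eq_mul]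
  ring

/-- Reflection `(u, v) ↦ (u, -v)`, which exchanges the null coordinates. -/
def reflect : Plane →L[ℝ] Plane :=
  (ContinuousLinearMap.fst ℝ ℝ ℝ).prod (-ContinuousLinearMap.snd ℝ ℝ ℝ)

@[simp] lemma reflect_apply (c : Plane) : reflect c = (c.1, -c.2) := rfl

lemma comp_reflect (H : IsNullFrame X A B A₁ B₁ V) :
    IsNullFrame (X ∘ reflect) (B ∘ reflect) (A ∘ reflect) (B₁ ∘ reflect) (A₁ ∘ reflect)
      (reflect ⁻¹' V) where
  isOpen := H.isOpen.preimage reflect.continuous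
  contDiffOn := H.contDiffOn.comp reflect.contDiff.contDiffOn (Set.mapsTo_preimage _ _)
  hasFDerivAt p hp := ((H.hasFDerivAt _ hp).comp p reflect.hasFDerivAt).congr_fderiv (by
    refine ContinuousLinearMap.ext fun c => ?_
    simp [← sub_eq_add_neg, add_comm])
  hasFDerivAt_a p hp := ((H.hasFDerivAt_b _ hp).comp p reflect.hasFDerivAt).congr_fderiv (by
    refine ContinuousLinearMap.ext fun c => ?_
    simp)
  hasFDerivAt_b p hp := ((H.hasFDerivAt_a _ hp).comp p reflect.hasFDerivAt).congr_fderiv (by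
    refine ContinuousLinearMap.ext fun c => ?_
    simp [← sub_eq_add_neg])
  dot_a_a p hp := H.dot_b_b _ hp
  dot_b_b p hp := H.dot_a_a _ hp
  dot_a_b p hp := by rw [Function.comp_apply, Function.comp_apply, dot_comm]; exact H.dot_a_b _ hp

/-- Near every point, an isometry pulls a minimal map back to a minimal map in the isothermal
coordinates of the source. -/
lemma exists_pullback (h : IsNullFrame x a b a₁ b₁ W) (H : IsNullFrame X A B A₁ B₁ V)
    {f : Plane → Plane} (hf : ContDiffOn ℝ ∞ f W) (hfV : Set.MapsTo f W V)
    (hiso : ∀ q ∈ W, ∀ c d : Plane,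
      dot (fderiv ℝ X (f q) (fderiv ℝ f q c)) (fderiv ℝ X (f q) (fderiv ℝ f q d)) =
        dot (fderiv ℝ x q c) (fderiv ℝ x q d)) (hp : p ∈ W) :
    ∃ (U : Set Plane) (a' b' a₁' b₁' : Plane → R42), p ∈ U ∧ U ⊆ W ∧
      IsNullFrame (X ∘ f) a' b' a₁' b₁' U ∧ ∀ q ∈ U, dot (a' q) (b' q) = dot (a q) (b q) ∧
      det4 (a' q) (b' q) (a₁' q) (b₁' q) / dot (a' q) (b' q) ^ 3 =
        det4 (A (f q)) (B (f q)) (A₁ (f q)) (B₁ (f q)) / dot (A (f q)) (B (f q)) ^ 3 := by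
  -- The basis dual to (σ, τ), consisting of null directions.
  set es : Plane := (1 / 2, 1 / 2) with hes
  set et : Plane := (1 / 2, -1 / 2) with het
  set D := fderiv ℝ f with hD
  have hDc : ContinuousOn D W := (hf.fderiv_of_isOpen h.isOpen (m := ∞) (by simp)).continuousOn
  have hc (ℓ : Plane →L[ℝ] ℝ) (e : Plane) : ContinuousOn (fun q => ℓ (D q e)) W :=
    ℓ.continuous.comp_continuousOn (hDc.clm_apply continuousOn_const)
  have hopen (ℓ : Plane →L[ℝ] ℝ) (e : Plane) (ℓ' : Plane →L[ℝ] ℝ) (e' : Plane) :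
      IsOpen {q ∈ W | ℓ (D q e) * ℓ' (D q e') ≠ 0} :=
    ((hc ℓ e).mul (hc ℓ' e')).isOpen_inter_preimage h.isOpen isOpen_ne
  have hmet (q) (hq : q ∈ W) (c d : Plane) : (sig (D q c) * tau (D q d) + tau (D q c) * sig (D q d)) *
      dot (A (f q)) (B (f q)) = (sig c * tau d + tau c * sig d) * dot (a q) (b q) := by
    have := hiso q hq c d
    rw [H.dot_fderiv_fderiv (hfV hq), h.dot_fderiv_fderiv hq] at this
    simpa using this
  -- An isometry sends null directions to null directions.
  have hss (q) (hq : q ∈ W) : sig (D q es) * tau (D q es) = 0 := by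
    have h1 := hmet q hq es es
    have h2 := (H.dot_a_b _ (hfV hq)).ne
    have h3 : tau es = 0 := by simp [hes]
    rw [h3, mul_zero, zero_mul, add_zero, zero_mul] at h1
    have := (mul_eq_zero.1 h1).resolve_right h2
    linarith
  have htt (q) (hq : q ∈ W) : sig (D q et) * tau (D q et) = 0 := by
    have h1 := hmet q hq et et
    have h2 := (H.dot_a_b _ (hfV hq)).ne
    have h3 : sig et = 0 := by simp [het]; norm_num
    rw [h3, mul_zero, zero_mul, add_zero, zero_mul] at h1
    have := (mul_eq_zero.1 h1).resolve_right h2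
    linarith
  have hst (q) (hq : q ∈ W) : (sig (D q es) * tau (D q et) + tau (D q es) * sig (D q et)) *
      dot (A (f q)) (B (f q)) = dot (a q) (b q) := by
    rw [hmet q hq es et]
    simp [hes, het]
    norm_num
  have hbasis (c : Plane) : c = sig c • es + tau c • et := by
    ext <;> simp [hes, het] <;> ring
  have hlin (ℓ : Plane →L[ℝ] ℝ) (q c : Plane) :
      ℓ (D q c) = sig c * ℓ (D q es) + tau c * ℓ (D q et) := by
    conv_lhs => rw [hbasis c]
    simp only [map_add, map_smul, smul_eq_mul]
  -- The isometry either keeps or exchanges the null directions at p, and the open nonvanishing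
  -- condition extends the alternative to a neighborhood. In the second case X ∘ f is read as (X ∘
  -- reflect) ∘ (reflect ∘ f), which exchanges a with b and a₁ with b₁ and so keeps the determinant.
  by_cases hcase : sig (D p es) * tau (D p et) ≠ 0
  · set U := {q ∈ W | sig (D q es) * tau (D q et) ≠ 0} with hU
    have hUW : U ⊆ W := fun q hq => hq.1
    have hz (q) (hq : q ∈ U) : tau (D q es) = 0 ∧ sig (D q et) = 0 := by
      obtain ⟨h1, h2⟩ := mul_ne_zero_iff.1 hq.2
      exact ⟨(mul_eq_zero.1 (hss q hq.1)).resolve_left h1,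
        (mul_eq_zero.1 (htt q hq.1)).resolve_right h2⟩
    have hE (q) (hq : q ∈ U) : sig (D q es) * tau (D q et) * dot (A (f q)) (B (f q)) =
        dot (a q) (b q) := by
      rw [← hst q hq.1, (hz q hq).1, zero_mul, add_zero]
    obtain ⟨m', k', hN⟩ := H.comp_of_null (W := U) (f := f) (m := fun q => sig (D q es))
      (k := fun q => tau (D q et)) (hopen sig es tau et) (hf.mono hUW) (hfV.mono_left hUW)
      (fun q hq => ContinuousLinearMap.ext fun c => by
        change sig (D q c) = _
        rw [hlin sig q c, (hz q hq).2]
        simp [mul_comm])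
      (fun q hq => ContinuousLinearMap.ext fun c => by
        change tau (D q c) = _
        rw [hlin tau q c, (hz q hq).1]
        simp [mul_comm])
      (fun q hq => by rw [hE q hq]; exact h.dot_a_b q hq.1)
    refine ⟨U, _, _, _, _, ⟨hp, hcase⟩, hUW, hN, fun q hq => ⟨?_, ?_⟩⟩
    · rw [dot_smul_left, dot_smul_right, ← hE q hq]; ring
    · have h1 := (H.dot_a_b _ (hfV (hUW hq))).ne
      obtain ⟨h2, h3⟩ := mul_ne_zero_iff.1 hq.2
      rw [det4_comp, dot_smul_left, dot_smul_right]
      field_simp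
  · have hcase' : tau (D p es) * sig (D p et) ≠ 0 := by
      intro h0
      have h1 := hst p hp
      rw [not_not.1 hcase, h0, zero_add, zero_mul] at h1
      exact (h.dot_a_b p hp).ne h1.symm
    set U := {q ∈ W | tau (D q es) * sig (D q et) ≠ 0} with hU
    have hUW : U ⊆ W := fun q hq => hq.1
    have hz (q) (hq : q ∈ U) : sig (D q es) = 0 ∧ tau (D q et) = 0 := by
      obtain ⟨h1, h2⟩ := mul_ne_zero_iff.1 hq.2
      exact ⟨(mul_eq_zero.1 (hss q hq.1)).resolve_right h1,
        (mul_eq_zero.1 (htt q hq.1)).resolve_left h2⟩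
    have hE (q) (hq : q ∈ U) : tau (D q es) * sig (D q et) * dot (A (f q)) (B (f q)) =
        dot (a q) (b q) := by
      rw [← hst q hq.1, (hz q hq).1, zero_mul, zero_add]
    have hrr (c : Plane) : reflect (reflect c) = c := by simp
    have hfr : Set.MapsTo (reflect ∘ f) U (reflect ⁻¹' V) := fun q hq => by
      rw [Set.mem_preimage, Function.comp_apply, hrr]
      exact hfV (hUW hq)
    have hfd (q) (hq : q ∈ U) : fderiv ℝ (reflect ∘ f) q = reflect ∘L D q :=
      (reflect.hasFDerivAt.comp q
        (differentiableAt_of_contDiffOn h.isOpen hf (hUW hq)).hasFDerivAt).fderiv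
    obtain ⟨m', k', hN⟩ := H.comp_reflect.comp_of_null (W := U) (f := reflect ∘ f)
      (m := fun q => tau (D q es)) (k := fun q => sig (D q et)) (hopen tau es sig et)
      (reflect.contDiff.comp_contDiffOn (hf.mono hUW)) hfr
      (fun q hq => ContinuousLinearMap.ext fun c => by
        rw [hfd q hq]
        have : tau (D q c) = (tau (D q es)) * sig c := by
          rw [hlin tau q c, (hz q hq).2]; ring
        simpa [← sub_eq_add_neg] using this)
      (fun q hq => ContinuousLinearMap.ext fun c => by
        rw [hfd q hq]
        have : sig (D q c) = (sig (D q et)) * tau c := by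
          rw [hlin sig q c, (hz q hq).1]; ring
        simpa using this)
      (fun q hq => by
        simp only [Function.comp_apply, hrr]
        rw [dot_comm, hE q hq]; exact h.dot_a_b q hq.1)
    have hX : (X ∘ reflect) ∘ (reflect ∘ f) = X ∘ f := by
      funext q
      simp only [Function.comp_apply, hrr]
    rw [hX] at hN
    refine ⟨U, _, _, _, _, ⟨hp, hcase'⟩, hUW, hN, fun q hq => ⟨?_, ?_⟩⟩
    · simp only [Function.comp_apply, hrr]
      rw [dot_smul_left, dot_smul_right, ← hE q hq, dot_comm (B _)]; ring
    · have h1 := (H.dot_a_b _ (hfV (hUW hq))).ne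
      obtain ⟨h2, h3⟩ := mul_ne_zero_iff.1 hq.2
      have hswap : det4 (B (f q)) (A (f q)) (B₁ (f q)) (A₁ (f q)) =
          det4 (A (f q)) (B (f q)) (A₁ (f q)) (B₁ (f q)) := by
        simp only [det4_eq]; ring
      simp only [Function.comp_apply, hrr]
      rw [det4_comp, dot_smul_left, dot_smul_right, hswap, dot_comm (B _)]
      field_simp

end IsNullFrame

/-! ### The local converse -/

/-- A function with prescribed product has vanishing derivative in a direction in which the
other factor and the product have vanishing derivatives. -/
lemma fderiv_eq_zero_of_mul_eq {E : Type*} [NormedAddCommGroup E] [NormedSpace ℝ E]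
    {ρ f F : E → ℝ} {f' F' : E →L[ℝ] ℝ} {p e : E} (hρ : DifferentiableAt ℝ ρ p)
    (hf : HasFDerivAt f f' p) (hF : HasFDerivAt F F' p) (h : ∀ᶠ q in nhds p, ρ q * f q = F q)
    (hf0 : f p ≠ 0) (hfe : f' e = 0) (hFe : F' e = 0) : fderiv ℝ ρ p e = 0 := by
  have h1 := (hρ.hasFDerivAt.fun_mul hf).unique (hF.congr_of_eventuallyEq h)
  have h2 := congrArg (fun g : E →L[ℝ] ℝ => g e) h1
  simpa [hfe, hFe, hf0] using h2

namespace IsNullFrame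

variable {x a b a₁ b₁ X A B A₁ B₁ : Plane → R42} {W V : Set Plane} {p : Plane}

/-- Apart from (a₁ · a₁)(b₁ · b₁), the Gram determinant contains only quantities determined by the
metric (`dot_derivatives_eq`). -/
lemma det4_sq (h : IsNullFrame x a b a₁ b₁ W) (hp : p ∈ W) :
    det4 (a p) (b p) (a₁ p) (b₁ p) ^ 2 =
      (dot (a p) (b p) * dot (a₁ p) (b₁ p) - dot (a p) (b₁ p) * dot (a₁ p) (b p)) ^ 2 -
        dot (a p) (b p) ^ 2 * (dot (a₁ p) (a₁ p) * dot (b₁ p) (b₁ p)) := by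
  rw [sq, det4_mul_det4]
  simp only [h.dot_a_a p hp, h.dot_b_b p hp, h.dot_a_a₁ hp, h.dot_b_b₁ hp, dot_comm (b p) (a p),
    dot_comm (a₁ p) (a p), dot_comm (b₁ p) (b p), dot_comm (b₁ p) (a p), dot_comm (b₁ p) (a₁ p),
    dot_comm (b p) (a₁ p)]
  rw [det4_eq]
  simp
  ring

/-- Two minimal maps with the same metric and the same determinant `det (a, b, a₁, b₁)` have
proportional scalar squares of `a₁`. -/
lemma exists_dot_a₁_eq_mul (h : IsNullFrame x a b a₁ b₁ W) (H : IsNullFrame X A B A₁ B₁ W)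
    (hW : IsPreconnected W) (hp : p ∈ W)
    (hE : ∀ q ∈ W, dot (A q) (B q) = dot (a q) (b q))
    (hf0 : ∀ q ∈ W, dot (a₁ q) (a₁ q) ≠ 0) (hg0 : ∀ q ∈ W, dot (b₁ q) (b₁ q) ≠ 0)
    (hdet : ∀ q ∈ W, det4 (A q) (B q) (A₁ q) (B₁ q) = det4 (a q) (b q) (a₁ q) (b₁ q)) :
    ∃ k : ℝ, k ≠ 0 ∧ ∀ q ∈ W, dot (A₁ q) (A₁ q) = k * dot (a₁ q) (a₁ q) := by
  have hprod (q) (hq : q ∈ W) : dot (A₁ q) (A₁ q) * dot (B₁ q) (B₁ q) =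
      dot (a₁ q) (a₁ q) * dot (b₁ q) (b₁ q) := by
    obtain ⟨e1, e2, e3⟩ := h.dot_derivatives_eq H hE hq
    have h1 := h.det4_sq hq
    have h2 := H.det4_sq hq
    rw [hdet q hq, hE q hq, e1, e2, e3, h1] at h2
    have h3 := pow_ne_zero 2 (h.dot_a_b q hq).ne
    exact mul_left_cancel₀ h3 (by linarith)
  have hAB0 (q) (hq : q ∈ W) : dot (A₁ q) (A₁ q) ≠ 0 ∧ dot (B₁ q) (B₁ q) ≠ 0 := by
    rw [← mul_ne_zero_iff, hprod q hq]
    exact mul_ne_zero (hf0 q hq) (hg0 q hq)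
  set ρ : Plane → ℝ := fun q => dot (A₁ q) (A₁ q) / dot (a₁ q) (a₁ q) with hρ
  obtain ⟨a₂, ha₂⟩ := h.hasFDerivAt_a₁
  obtain ⟨A₂, hA₂⟩ := H.hasFDerivAt_a₁
  obtain ⟨b₂, hb₂⟩ := h.hasFDerivAt_b₁
  obtain ⟨B₂, hB₂⟩ := H.hasFDerivAt_b₁
  have hρd (q) (hq : q ∈ W) : DifferentiableAt ℝ ρ q :=
    differentiableAt_fun_div (f := fun q => dot (A₁ q) (A₁ q))
      (hasFDerivAt_dot (hA₂ q hq) (hA₂ q hq)).differentiableAt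
      (hasFDerivAt_dot (ha₂ q hq) (ha₂ q hq)).differentiableAt (hf0 q hq)
  have hρ0 (q) (hq : q ∈ W) : fderiv ℝ ρ q = 0 := by
    -- Along τ both a₁ · a₁ and A₁ · A₁ are constant. Along σ one uses ρ = (b₁ · b₁) / (B₁ · B₁),
    -- which follows from `hprod`.
    have ht : fderiv ℝ ρ q (1 / 2, -1 / 2) = 0 := by
      refine fderiv_eq_zero_of_mul_eq (hρd q hq) (hasFDerivAt_dot (ha₂ q hq) (ha₂ q hq))
        (hasFDerivAt_dot (hA₂ q hq) (hA₂ q hq)) ?_ (hf0 q hq) ?_ ?_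
      · filter_upwards [h.isOpen.mem_nhds hq] with r hr using div_mul_cancel₀ _ (hf0 r hr)
      · norm_num [dot_zero_left, dot_zero_right]
      · norm_num [dot_zero_left, dot_zero_right]
    have hs : fderiv ℝ ρ q (1 / 2, 1 / 2) = 0 := by
      refine fderiv_eq_zero_of_mul_eq (hρd q hq) (hasFDerivAt_dot (hB₂ q hq) (hB₂ q hq))
        (hasFDerivAt_dot (hb₂ q hq) (hb₂ q hq)) ?_ (hAB0 q hq).2 ?_ ?_
      · filter_upwards [h.isOpen.mem_nhds hq] with r hr
        have := hf0 r hr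
        rw [hρ, div_mul_eq_mul_div, hprod r hr]
        field_simp
      · norm_num [dot_zero_left, dot_zero_right]
      · norm_num [dot_zero_left, dot_zero_right]
    refine ContinuousLinearMap.ext fun e => ?_
    have he : e = (e.1 + e.2) • ((1 / 2, 1 / 2) : Plane) + (e.1 - e.2) • ((1 / 2, -1 / 2) : Plane) := by
      ext <;> simp <;> ring
    rw [he, map_add, map_smul, map_smul, hs, ht]
    simp
  refine ⟨ρ p, div_ne_zero (hAB0 p hp).1 (hf0 p hp), fun q hq => ?_⟩
  rw [← h.isOpen.is_const_of_fderiv_eq_zero hW (fun r hr => (hρd r hr).differentiableWithinAt)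
    (fun r hr => hρ0 r hr) hq hp, hρ, div_mul_cancel₀ _ (hf0 q hq)]

end IsNullFrame

/-- The diffeomorphism is restricted to W; its image is open, being the preimage of W under the
inverse. -/
lemma isLocalProperMotion_of_diffeo {K N : Patch} {U V W : Set Plane} {f : Plane → Plane}
    {p₀ : Plane} (hV : IsOpen V) (hVN : V ⊆ N.domain) (hf : IsDiffeoOn f U V)
    (hW : IsOpen W) (hWU : W ⊆ U) (hWK : W ⊆ K.domain) (hp₀ : p₀ ∈ W)
    {L : Matrix (Fin 4) (Fin 4) ℝ} {d : R42} (hL : IsProperMotion L)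
    (h : ∀ q ∈ W, N.map (f q) = L.mulVec (K.map q) + d) : IsLocalProperMotion K p₀ N (f p₀) := by
  obtain ⟨hfs, hfV, g, hgs, hgU, hgl, hgr⟩ := hf
  have himg : f '' W = V ∩ g ⁻¹' W := by
    ext q
    constructor
    · rintro ⟨r, hr, rfl⟩
      exact ⟨hfV (hWU hr), by rwa [Set.mem_preimage, hgl (hWU hr)]⟩
    · rintro ⟨hq, hgq⟩
      exact ⟨g q, hgq, hgr hq⟩
  have himgV : f '' W ⊆ V := himg ▸ Set.inter_subset_left
  refine ⟨W, f '' W, f, L, d, hW, hp₀, hWK, ?_, Set.mem_image_of_mem f hp₀, himgV.trans hVN,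
    ⟨hfs.mono hWU, Set.mapsTo_image f W, g, hgs.mono himgV, ?_, fun q hq => hgl (hWU hq),
      fun q hq => hgr (himgV hq)⟩, rfl, hL, h⟩
  · rw [himg]
    exact hgs.continuousOn.isOpen_inter_preimage hV hW
  · rw [himg]
    exact fun q hq => hq.2

/-- A minimal time-like surface that is strongly isometric to a minimal time-like surface of
general type is locally congruent to a member of one of the two families. -/
lemma exists_isLocalProperMotion {M N : Patch} (hM : IsGeneralType M) (hN : IsMinimal N)
    {U V : Set Plane} {f : Plane → Plane} {p₀ : Plane} (hU : IsOpen U) (hp₀ : p₀ ∈ U)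
    (hUM : U ⊆ M.domain) (hV : IsOpen V) (hVN : V ⊆ N.domain)
    (hf : IsStrongIsometry (M.restrict U) (N.restrict V) f) :
    ∃ θ : ℝ,
      (∀ (O : Set Plane) (y : Plane → R42), IsOpen O → p₀ ∈ O → O ⊆ M.domain →
        IsHarmonicConjugate (M.restrict O) y →
        IsLocalProperMotion ((M.restrict O).associated y θ) p₀ N (f p₀)) ∨
      (∀ (O : Set Plane) (y : Plane → R42) (A : Matrix (Fin 4) (Fin 4) ℝ) (c : R42)
        (z : Plane → R42), IsOpen O → p₀ ∈ O → O ⊆ M.domain →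
        IsConjAntiData (M.restrict O) y A c z →
        IsLocalProperMotion ((M.restrict O).conjAntiAssociated y A c z θ) p₀ N (f p₀)) := by
  obtain ⟨a, b, a₁, b₁, h⟩ := hM.toIsMinimal.exists_isNullFrame
  obtain ⟨A, B, A₁, B₁, H⟩ := hN.exists_isNullFrame
  obtain ⟨⟨hdiff, hmet⟩, hcurv⟩ := hf
  obtain ⟨U', a', b', a₁', b₁', hpU', hU'U, h', heq⟩ := (h.mono hU hUM).exists_pullback
    (H.mono hV hVN) hdiff.1 hdiff.2.1 hmet hp₀
  -- A ball is connected, as the constancy arguments require.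
  obtain ⟨r, hr, hball⟩ := Metric.isOpen_iff.1 h'.isOpen p₀ hpU'
  set W := Metric.ball p₀ r with hW
  have hWU : W ⊆ U := hball.trans hU'U
  have hfg (q) (hq : q ∈ M.domain) := h.dot_ne_zero_of_not_isDegenerate hq (hM.nondegenerate q hq)
  have hWM : W ⊆ M.domain := hWU.trans hUM
  have hx := h.mono Metric.isOpen_ball hWM
  have hX := h'.mono Metric.isOpen_ball hball
  have hE (q) (hq : q ∈ W) : dot (a' q) (b' q) = dot (a q) (b q) := (heq q (hball hq)).1
  have hdet (q) (hq : q ∈ W) :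
      det4 (a' q) (b' q) (a₁' q) (b₁' q) = det4 (a q) (b q) (a₁ q) (b₁ q) := by
    obtain ⟨k, hk1, hk2⟩ := hcurv q (hWU hq)
    have e1 := h.normalCurvature_eq (hWM hq) hk1
    have e2 := H.normalCurvature_eq (hVN (hdiff.2.1 (hWU hq))) hk2
    have e3 := (heq q (hball hq)).2
    have h0 := (h.dot_a_b q (hWM hq)).ne
    rw [e1, neg_div, neg_div, neg_inj, ← e3, hE q hq] at e2
    field_simp at e2
    exact e2.symm
  obtain ⟨k, hk0, hk⟩ := hx.exists_dot_a₁_eq_mul hX (convex_ball p₀ r).isPreconnected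
    (Metric.mem_ball_self hr) hE (fun q hq => (hfg q (hWM hq)).1)
    (fun q hq => (hfg q (hWM hq)).2) hdet
  -- it is enough to have a map with the same invariants as the pulled back map
  have main {K : Patch} {α β α₁ β₁ : Plane → R42}
      (hK : IsNullFrame K.map α β α₁ β₁ K.domain) (hKM : K.domain ⊆ M.domain)
      (hpK : p₀ ∈ K.domain) (hKE : ∀ q, dot (α q) (β q) = dot (a q) (b q))
      (hKf : ∀ q, dot (α₁ q) (α₁ q) = k * dot (a₁ q) (a₁ q))
      (hKg : ∀ q ∈ M.domain, dot (β₁ q) (β₁ q) ≠ 0)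
      (hKd : ∀ q, det4 (α q) (β q) (α₁ q) (β₁ q) = det4 (a q) (b q) (a₁ q) (b₁ q)) :
      IsLocalProperMotion K p₀ N (f p₀) := by
    obtain ⟨s, hs, hsball⟩ := Metric.isOpen_iff.1 (Metric.isOpen_ball.inter hK.isOpen) p₀
      ⟨Metric.mem_ball_self hr, hpK⟩
    have hsW : Metric.ball p₀ s ⊆ W := fun q hq => (hsball hq).1
    have hsK : Metric.ball p₀ s ⊆ K.domain := fun q hq => (hsball hq).2
    obtain ⟨L, d, hL, hLd⟩ := (hK.mono Metric.isOpen_ball hsK).exists_motion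
      (hX.mono Metric.isOpen_ball hsW) (convex_ball p₀ s).isPreconnected
      ⟨p₀, Metric.mem_ball_self hs⟩ (fun q hq => by rw [hE q (hsW hq), hKE])
      (fun q hq => by rw [hk q (hsW hq), hKf])
      (fun q hq => by rw [hKf]; exact mul_ne_zero hk0 (hfg q (hWM (hsW hq))).1)
      (fun q hq => hKg q (hWM (hsW hq))) (fun q hq => by rw [hdet q (hsW hq), hKd])
    exact isLocalProperMotion_of_diffeo hV hVN hdiff Metric.isOpen_ball (hsW.trans hWU) hsK
      (Metric.mem_ball_self hs) hL hLd
  have hexp (t : ℝ) (ht : 0 < t) : Real.exp (Real.log t / 2) * Real.exp (Real.log t / 2) = t := by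
    rw [← Real.exp_add, add_halves, Real.exp_log ht]
  -- The sign of k selects the family and e^{2θ} = |k| the member. The choice does not involve O, y,
  -- A, c or z, so one θ serves them all.
  rcases lt_or_gt_of_ne hk0 with hneg | hpos
  · refine ⟨Real.log (-k) / 2, Or.inr fun O y L c z hO hpO hOM hd => ?_⟩
    have hfr := IsNullFrame.conjAntiAssociated (M := M.restrict O) (h.mono hO hOM) hd
      (Real.log (-k) / 2)
    refine main (K := (M.restrict O).conjAntiAssociated y L c z _) hfr hOM hpO (fun q => ?_)
      (fun q => ?_) (fun q hq => ?_) (fun q => ?_)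
    · rw [IsNullFrame.dot_exp_smul, dot_neg_right, hd.anti_A.1, neg_neg]
    · rw [dot_smul_left, dot_smul_right, hd.anti_A.1, ← mul_assoc, hexp _ (neg_pos.2 hneg)]
      ring
    · simp [dot_smul_left, dot_smul_right, dot_neg_left, dot_neg_right, hd.anti_A.1, (hfg q hq).2]
    · rw [IsNullFrame.det4_exp_smul, IsNullFrame.det4_conj_anti hd.anti_A.2]
  · refine ⟨Real.log k / 2, Or.inl fun O y hO hpO hOM hy => ?_⟩
    have hfr := IsNullFrame.associated (M := M.restrict O) (h.mono hO hOM) hy (Real.log k / 2)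
    refine main (K := (M.restrict O).associated y _) hfr hOM hpO
      (fun q => IsNullFrame.dot_exp_smul _ _ _) (fun q => ?_) (fun q hq => ?_)
      (fun q => IsNullFrame.det4_exp_smul _ _ _ _ _)
    · rw [dot_smul_left, dot_smul_right, ← mul_assoc, hexp _ hpos]
    · simp [dot_smul_left, dot_smul_right, (hfg q hq).2]

end TimelikeSurface

open TimelikeSurface in
theorem mainTheorem9 (M : Patch) (hM : IsGeneralType M) :
    -- near every point of `M` the families `M_θ` and `M̄^a_θ` exist
    (∀ p ∈ M.domain, ∃ U : Set Plane, IsOpen U ∧ p ∈ U ∧ U ⊆ M.domain ∧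
      ∃ y A c z, IsConjAntiData (M.restrict U) y A c z) ∧
    -- the surfaces `M_θ` are minimal time-like and strongly isometric to `M`
    (∀ y, IsHarmonicConjugate M y → ∀ θ : ℝ,
      IsMinimal (M.associated y θ) ∧ IsStrongIsometry M (M.associated y θ) id) ∧
    -- the surfaces `M̄^a_θ` are minimal time-like and strongly isometric to `M`
    (∀ y A c z, IsConjAntiData M y A c z → ∀ θ : ℝ,
      IsMinimal (M.conjAntiAssociated y A c z θ) ∧
        IsStrongIsometry M (M.conjAntiAssociated y A c z θ) id) ∧
    -- conversely, locally there are no other minimal surfaces strongly isometric to `M`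
    (∀ N : Patch, IsGeneralType N → ∀ p₀ ∈ M.domain, ∀ q₀ ∈ N.domain,
      ∀ (U V : Set Plane) (f : Plane → Plane),
        IsOpen U → p₀ ∈ U → U ⊆ M.domain → IsOpen V → q₀ ∈ V → V ⊆ N.domain →
        IsStrongIsometry (M.restrict U) (N.restrict V) f → f p₀ = q₀ →
        ∃ θ : ℝ,
          (∀ (O : Set Plane) (y : Plane → R42), IsOpen O → p₀ ∈ O → O ⊆ M.domain →
            IsHarmonicConjugate (M.restrict O) y →
            IsLocalProperMotion ((M.restrict O).associated y θ) p₀ N q₀) ∨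
          (∀ (O : Set Plane) (y : Plane → R42) (A : Matrix (Fin 4) (Fin 4) ℝ) (c : R42)
            (z : Plane → R42), IsOpen O → p₀ ∈ O → O ⊆ M.domain →
            IsConjAntiData (M.restrict O) y A c z →
            IsLocalProperMotion ((M.restrict O).conjAntiAssociated y A c z θ) p₀ N q₀)) := by
  obtain ⟨a, b, a₁, b₁, h⟩ := hM.toIsMinimal.exists_isNullFrame
  have hf (q) (hq : q ∈ M.domain) : dot (a₁ q) (a₁ q) ≠ 0 :=
    (h.dot_ne_zero_of_not_isDegenerate hq (hM.nondegenerate q hq)).1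
  refine ⟨fun p hp => ?_, fun y hy θ => h.associated_isStrongIsometry hf hy θ,
    fun y A c z hd θ => h.conjAntiAssociated_isStrongIsometry hf hd θ, ?_⟩
  · obtain ⟨r, hr, hball⟩ := Metric.isOpen_iff.1 h.isOpen p hp
    exact ⟨Metric.ball p r, Metric.isOpen_ball, Metric.mem_ball_self hr, hball,
      IsNullFrame.exists_isConjAntiData (M := M.restrict (Metric.ball p r))
        (h.mono Metric.isOpen_ball hball) (convex_ball p r)⟩
  · rintro N hN p₀ - q₀ - U V f hU hpU hUM hV - hVN hiso rfl
    exact exists_isLocalProperMotion hM hN.toIsMinimal hU hpU hUM hV hVN hiso
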